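/- A NAC-colouring of a graph $G$ is a surjective map $E(G)\to\{\text{red},\text{blue}\}$ such that no cycle of $G$ contains exactly one red edge or exactly one blue edge. Let $G(n,p)$ denote the binomial random graph on $n$ labelled vertices, in which each pair of vertices is an edge independently with probability $p$. Then $f(n)=\sqrt[3]{\frac{2\log n}{n^2}}$ is a sharp threshold in $G(n,p)$ for the property of being connected and having no NAC-colouring. That is, for every $\varepsilon>0$ and every sequence $p=p(n)\in[0,1]$: (i) if $p(n)>(1+\varepsilon)f(n)$ for all sufficiently large $n$, then $$\lim_{n\to\infty}\Pr\bigl[G(n,p(n))\text{ is connected and has no NAC-colouring}\bigr]=1;$$ (ii) if $p(n)<(1-\varepsilon)f(n)$ for all sufficiently large $n$, then $$\lim_{n\to\infty}\Pr\bigl[G(n,p(n))\text{ is connected and has no NAC-colouring}\bigr]=0.$$ -/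

import Mathlib

open MeasureTheory Filter Topology
open scoped unitInterval

/-- The two colours used in a NAC-colouring. -/
inductive EdgeColour where
  | red : EdgeColour
  | blue : EdgeColour

/-- A NAC-colouring of `G`: a surjective map from the edges of `G` to `{red, blue}` such that no
cycle of `G` contains exactly one edge of some colour. -/
def IsNACColouring {V : Type*} (G : SimpleGraph V) (c : G.edgeSet → EdgeColour) : Prop :=
  Function.Surjective c ∧
    ∀ (v : V) (w : G.Walk v v), w.IsCycle →
      (¬ ∃! e : G.edgeSet, (e : Sym2 V) ∈ w.edges ∧ c e = EdgeColour.red) ∧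
      (¬ ∃! e : G.edgeSet, (e : Sym2 V) ∈ w.edges ∧ c e = EdgeColour.blue)

/-- The property of being connected and having no NAC-colouring. -/
def ConnectedNoNAC {V : Type*} (G : SimpleGraph V) : Prop :=
  G.Connected ∧ ¬ ∃ c : G.edgeSet → EdgeColour, IsNACColouring G c

/-- The binomial random graph `G(n, p n)` on the vertex set `Fin n` asymptotically almost surely
has the property `P`: the probability of `P` tends to `1` as `n → ∞`. -/
def AsymptoticallyAlmostSurely (p : ℕ → I) (P : ∀ n : ℕ, SimpleGraph (Fin n) → Prop) : Prop :=
  Tendsto (fun n : ℕ => SimpleGraph.binomialRandom (Fin n) (p n) {G | P n G}) atTop (𝓝 1)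

/-- `f` is a sharp threshold for the property `P` in the binomial random graph. -/
def IsSharpThreshold (f : ℕ → ℝ) (P : ∀ n : ℕ, SimpleGraph (Fin n) → Prop) : Prop :=
  ∀ ε : ℝ, 0 < ε → ∀ p : ℕ → I,
    ((∀ᶠ n in atTop, (1 + ε) * f n < (p n : ℝ)) → AsymptoticallyAlmostSurely p P) ∧
    ((∀ᶠ n in atTop, (p n : ℝ) < (1 - ε) * f n) →
      AsymptoticallyAlmostSurely p (fun n G => ¬ P n G))

/-!
The threshold for having no NAC-colouring is the threshold for every vertex to lie in a triangle.
If `p = l * f n`, then a vertex lies in `n ^ 2 * p ^ 3 / 2 = l ^ 3 * log n` triangles on average, and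
it lies in no triangle with probability `n ^ (-l ^ 3 + o(1))`.

*Below the threshold.* In a connected graph, a vertex in no triangle gives a NAC-colouring: colour
its edges red and all other edges blue (`exists_isNACColouring_of_no_triangle`). To find such a
vertex, fix a set `S` of about `n ^ (1 - θ)` vertices and the graph `H` outside `S`. Given `H`, the
events that a vertex `v` of `S` forms no triangle with an edge of `H` are independent, and each has
probability at least `(1 - p ^ 2) ^ |H|` by Harris's inequality (`le_bprob_avoid`). Triangles with
two vertices in `S` are rare, also conditionally on such an event. Hence the second moment method
applies (`bprob_not_exists_le`).

*Above the threshold.* In a NAC-colouring, every edge joins two vertices of the same red component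
or of the same blue component, but not both. If any two linearly large sets of vertices are joined
by an edge, this forces one component, say a red one, to contain all but a small set `U` of the
vertices (`exists_saturated_or_class`). Edges leaving `U` are then blue, so no vertex of `U` forms a
triangle with two vertices outside `U`. The same holds if the graph is disconnected and `U` is a
small union of components. Graphs for which this is impossible are called mixing (`IsMixing`), and
they are connected without NAC-colourings (`IsMixing.connectedNoNAC`). For a fixed `U`, Janson's
inequality (`bprob_avoid_le`), applied to all triangles with one vertex in `U` and the other two
outside `U`, bounds the probability of the exceptional situation by `n ^ (-(1 + η) * |U|)`, and
this can be summed over all nonempty `U`. Being mixing is an increasing property, so that it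
suffices to consider `p = (1 + ε) * f n`.

The random graph is treated as a random set of pairs of vertices, with expectations written as
finite sums (`bexp`, `bprob`). The basic tool is `bexp_superset`: conditioning on containing a
set `T` amounts to adding `T` to the random set.
-/

/-! ### Random subsets of a finite set -/

section RandomSubset

variable {α : Type*} [DecidableEq α]

/-- The expectation of `f S`, where `S` is the random subset of `A` that contains every element
of `A` independently with probability `p`. -/
noncomputable def bexp (p : ℝ) (A : Finset α) (f : Finset α → ℝ) : ℝ :=
  ∑ S ∈ A.powerset, p ^ S.card * (1 - p) ^ (A \ S).card * f S

open Classical in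
/-- The probability that the random subset of `A` containing every element of `A` independently
with probability `p` has the property `P`. -/
noncomputable def bprob (p : ℝ) (A : Finset α) (P : Finset α → Prop) : ℝ :=
  bexp p A fun S => if P S then 1 else 0

variable {p : ℝ} {A B : Finset α} {f g : Finset α → ℝ} {P Q : Finset α → Prop}

@[simp] lemma bexp_empty : bexp p ∅ f = f ∅ := by simp [bexp]

/-- Conditioning on whether `a` belongs to the random set. -/
lemma bexp_insert {a : α} (ha : a ∉ A) :
    bexp p (insert a A) f = (1 - p) * bexp p A f + p * bexp p A fun S => f (insert a S) := by
  unfold bexp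
  rw [Finset.sum_powerset_insert ha, Finset.mul_sum, Finset.mul_sum]
  congr 1
  · refine Finset.sum_congr rfl fun S hS => ?_
    have haS : a ∉ S := fun h => ha (Finset.mem_powerset.1 hS h)
    rw [Finset.insert_sdiff_of_notMem _ haS, Finset.card_insert_of_notMem (by simp [ha])]
    ring
  · refine Finset.sum_congr rfl fun S hS => ?_
    have haS : a ∉ S := fun h => ha (Finset.mem_powerset.1 hS h)
    rw [Finset.insert_sdiff_insert, Finset.sdiff_insert_of_notMem ha,
      Finset.card_insert_of_notMem haS]
    ring

lemma bexp_congr (h : ∀ S ⊆ A, f S = g S) : bexp p A f = bexp p A g :=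
  Finset.sum_congr rfl fun S hS => by rw [h S (Finset.mem_powerset.1 hS)]

lemma bexp_mono (h0 : 0 ≤ p) (h1 : p ≤ 1) (h : ∀ S ⊆ A, f S ≤ g S) : bexp p A f ≤ bexp p A g := by
  refine Finset.sum_le_sum fun S hS => mul_le_mul_of_nonneg_left (h S (Finset.mem_powerset.1 hS)) ?_
  have : 0 ≤ 1 - p := by linarith
  positivity

lemma bexp_add : bexp p A (fun S => f S + g S) = bexp p A f + bexp p A g := by
  simp [bexp, mul_add, Finset.sum_add_distrib]

lemma bexp_sub : bexp p A (fun S => f S - g S) = bexp p A f - bexp p A g := by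
  simp [bexp, mul_sub, Finset.sum_sub_distrib]

lemma bexp_const_mul (c : ℝ) : bexp p A (fun S => c * f S) = c * bexp p A f := by
  simp only [bexp, Finset.mul_sum]
  exact Finset.sum_congr rfl fun _ _ => by ring

lemma bexp_sum {ι : Type*} (J : Finset ι) (f : ι → Finset α → ℝ) :
    bexp p A (fun S => ∑ i ∈ J, f i S) = ∑ i ∈ J, bexp p A (f i) := by
  simp only [bexp, Finset.mul_sum]
  exact Finset.sum_comm

@[simp] lemma bexp_const (c : ℝ) : bexp p A (fun _ => c) = c := by
  induction A using Finset.induction_on with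
  | empty => simp
  | insert a A ha ih => rw [bexp_insert ha, ih]; ring

lemma bexp_nonneg (h0 : 0 ≤ p) (h1 : p ≤ 1) (h : ∀ S ⊆ A, 0 ≤ f S) : 0 ≤ bexp p A f := by
  have := bexp_mono (f := fun _ => 0) h0 h1 h
  rwa [bexp_const] at this

/-- Fubini's theorem: the random subset of a disjoint union is the union of two independent random
subsets. -/
lemma bexp_union (h : Disjoint A B) :
    bexp p (A ∪ B) f = bexp p A fun S => bexp p B fun T => f (S ∪ T) := by
  induction A using Finset.induction_on generalizing f with
  | empty => simp
  | insert a A ha ih =>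
    rw [Finset.disjoint_insert_left] at h
    rw [Finset.insert_union, bexp_insert (by simp [ha, h.1]), bexp_insert ha, ih h.2, ih h.2]
    simp only [Finset.insert_union]

/-- Conditioned on containing `T`, the random set is distributed as its union with `T`. -/
lemma bexp_superset {T : Finset α} (hT : T ⊆ A) :
    bexp p A (fun S => if T ⊆ S then f S else 0) = p ^ T.card * bexp p A fun S => f (T ∪ S) := by
  induction T using Finset.induction_on generalizing f with
  | empty => simp
  | insert a T ha ih =>
    have key (g : Finset α → ℝ) : bexp p A (fun S => if a ∈ S then g S else 0) =
        p * bexp p A fun S => g (insert a S) := by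
      obtain ⟨A', ha', rfl⟩ : ∃ A', a ∉ A' ∧ insert a A' = A :=
        ⟨A.erase a, by simp, Finset.insert_erase (hT (by simp))⟩
      rw [bexp_insert ha', bexp_insert ha']
      have : bexp p A' (fun S => if a ∈ S then g S else 0) = 0 := by
        refine (bexp_congr fun S hS => ?_).trans (bexp_const (p := p) (A := A') 0)
        exact if_neg fun h => ha' (hS h)
      simp only [this, Finset.mem_insert_self, if_true, Finset.insert_idem]
      ring
    have : (fun S : Finset α => if insert a T ⊆ S then f S else 0) =
        fun S => if a ∈ S then (if T ⊆ S then f S else 0) else 0 := by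
      ext S; simp only [Finset.insert_subset_iff, ite_and]
    rw [this, key, Finset.card_insert_of_notMem ha]
    have : (fun S : Finset α => if T ⊆ insert a S then f (insert a S) else 0) =
        fun S => if T ⊆ S then f (insert a S) else 0 := by
      ext S; simp only [Finset.subset_insert_iff_of_notMem ha]
    rw [this, ih (f := fun S => f (insert a S)) fun x hx => hT (Finset.mem_insert_of_mem hx)]
    simp only [Finset.insert_union, pow_succ]
    ring

/-- The probability generating function of the binomial distribution. -/
lemma bexp_pow_card_inter {T : Finset α} (hT : T ⊆ A) (z : ℝ) :
    bexp p A (fun S => z ^ (S ∩ T).card) = (1 + p * (z - 1)) ^ T.card := by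
  induction A using Finset.induction_on generalizing T with
  | empty => simp [Finset.subset_empty.1 hT]
  | insert a A ha ih =>
    rw [bexp_insert ha]
    by_cases haT : a ∈ T
    · obtain ⟨T', ha', rfl⟩ : ∃ T', a ∉ T' ∧ insert a T' = T :=
        ⟨T.erase a, by simp, Finset.insert_erase haT⟩
      have hT' : T' ⊆ A := (Finset.insert_subset_insert_iff ha').1 hT
      have h1 : bexp p A (fun S => z ^ (S ∩ insert a T').card) =
          bexp p A (fun S => z ^ (S ∩ T').card) :=
        bexp_congr fun S hS => by rw [Finset.inter_insert_of_notMem fun h => ha (hS h)]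
      have h2 : bexp p A (fun S => z ^ (insert a S ∩ insert a T').card) =
          z * bexp p A (fun S => z ^ (S ∩ T').card) := by
        rw [← bexp_const_mul]
        refine bexp_congr fun S hS => ?_
        rw [← Finset.insert_inter_distrib, Finset.card_insert_of_notMem (by simp [ha']), pow_succ']
      rw [h1, h2, ih hT', Finset.card_insert_of_notMem ha', pow_succ']
      ring
    · simp only [Finset.insert_inter_of_notMem haT]
      rw [ih ((Finset.subset_insert_iff_of_notMem haT).1 hT)]
      ring

/-- Functions of disjoint parts of the random set are independent. -/
lemma bexp_mul_of_disjoint {B C : Finset α} (hBC : Disjoint B C) (hf : ∀ S, f S = f (S ∩ B))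
    (hg : ∀ S, g S = g (S ∩ C)) :
    bexp p A (fun S => f S * g S) = bexp p A f * bexp p A g := by
  induction A using Finset.induction_on generalizing f g with
  | empty => simp
  | insert a A ha ih =>
    rw [bexp_insert ha, bexp_insert ha, bexp_insert ha]
    have hins {h : Finset α → ℝ} {D : Finset α} (hh : ∀ S, h S = h (S ∩ D)) (S : Finset α) :
        h (insert a S) = h (insert a (S ∩ D)) := by
      rw [hh, hh (insert a (S ∩ D))]
      congr 1
      ext x; simp; tauto
    have hout {h : Finset α → ℝ} {D : Finset α} (hh : ∀ S, h S = h (S ∩ D)) (hD : a ∉ D)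
        (S : Finset α) : h (insert a S) = h S := by
      rw [hh, hh S, Finset.insert_inter_of_notMem hD]
    rw [ih hf hg, ih (hins hf) (hins hg)]
    by_cases haB : a ∈ B
    · simp only [hout hg (Finset.disjoint_left.1 hBC haB)]
      ring
    · simp only [hout hf haB]
      ring

/-- The expectation of an increasing function of the random set increases with `p`. -/
lemma bexp_mono_param {q : ℝ} (h0 : 0 ≤ p) (hpq : p ≤ q) (h1 : q ≤ 1) (hf : Monotone f) :
    bexp p A f ≤ bexp q A f := by
  induction A using Finset.induction_on generalizing f with
  | empty => simp
  | insert a A ha ih =>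
    rw [bexp_insert ha, bexp_insert ha]
    have hf' : Monotone fun S => f (insert a S) := fun S T h => hf (Finset.insert_subset_insert a h)
    have h2 := ih hf
    have h3 := ih hf'
    have h4 : bexp p A f ≤ bexp p A fun S => f (insert a S) :=
      bexp_mono h0 (hpq.trans h1) fun S _ => hf (Finset.subset_insert a S)
    nlinarith [mul_nonneg (sub_nonneg.2 h1) (sub_nonneg.2 h2),
      mul_nonneg (h0.trans hpq) (sub_nonneg.2 h3), mul_nonneg (sub_nonneg.2 hpq) (sub_nonneg.2 h4)]

/-! ### Probabilities of random subsets -/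

lemma bprob_nonneg (h0 : 0 ≤ p) (h1 : p ≤ 1) : 0 ≤ bprob p A P :=
  bexp_nonneg h0 h1 fun S _ => by split_ifs <;> norm_num

lemma bprob_mono (h0 : 0 ≤ p) (h1 : p ≤ 1) (h : ∀ S ⊆ A, P S → Q S) : bprob p A P ≤ bprob p A Q :=
  bexp_mono h0 h1 fun S hS => by
    have := h S hS
    split_ifs <;> first | tauto | norm_num

lemma bprob_congr (h : ∀ S ⊆ A, P S ↔ Q S) : bprob p A P = bprob p A Q :=
  bexp_congr fun S hS => by rw [propext (h S hS)]

lemma bprob_le_one (h0 : 0 ≤ p) (h1 : p ≤ 1) : bprob p A P ≤ 1 := by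
  rw [← bexp_const (p := p) (A := A) 1]
  exact bexp_mono h0 h1 fun S _ => by split_ifs <;> norm_num

lemma bprob_not : bprob p A (fun S => ¬ P S) = 1 - bprob p A P := by
  rw [eq_sub_iff_add_eq, bprob, bprob, ← bexp_add, ← bexp_const (p := p) (A := A) 1]
  exact bexp_congr fun S _ => by split_ifs <;> norm_num

lemma bprob_or_le (h0 : 0 ≤ p) (h1 : p ≤ 1) :
    bprob p A (fun S => P S ∨ Q S) ≤ bprob p A P + bprob p A Q := by
  rw [bprob, bprob, bprob, ← bexp_add]
  exact bexp_mono h0 h1 fun S _ => by split_ifs <;> first | tauto | norm_num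

lemma bprob_exists_le (h0 : 0 ≤ p) (h1 : p ≤ 1) {ι : Type*} (J : Finset ι)
    (P : ι → Finset α → Prop) :
    bprob p A (fun S => ∃ i ∈ J, P i S) ≤ ∑ i ∈ J, bprob p A (P i) := by
  classical
  simp only [bprob]
  rw [← bexp_sum]
  refine bexp_mono h0 h1 fun S _ => ?_
  have hnn : ∀ i ∈ J, (0 : ℝ) ≤ if P i S then 1 else 0 := fun i _ => by split_ifs <;> norm_num
  split_ifs with h
  · obtain ⟨i, hi, hPi⟩ := h
    have := Finset.single_le_sum hnn hi
    rwa [if_pos hPi] at this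
  · exact Finset.sum_nonneg hnn

/-- Markov's inequality. -/
lemma bprob_le_bexp (h0 : 0 ≤ p) (h1 : p ≤ 1) (hf : ∀ S ⊆ A, 0 ≤ f S)
    (h : ∀ S ⊆ A, P S → 1 ≤ f S) : bprob p A P ≤ bexp p A f :=
  bexp_mono h0 h1 fun S hS => by
    split_ifs with hP
    exacts [h S hS hP, hf S hS]

/-- If every outcome of the first stage gives the event probability at most `c`, then the event has
probability at most `c`. -/
lemma bprob_union_le (h0 : 0 ≤ p) (h1 : p ≤ 1) (hAB : Disjoint A B) {c : ℝ}
    (h : ∀ S ⊆ A, bprob p B (fun T => P (S ∪ T)) ≤ c) : bprob p (A ∪ B) P ≤ c := by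
  rw [bprob, bexp_union hAB, ← bexp_const (p := p) (A := A) c]
  exact bexp_mono h0 h1 h

lemma bprob_mono_param {q : ℝ} (h0 : 0 ≤ p) (hpq : p ≤ q) (h1 : q ≤ 1)
    (hP : ∀ S T, S ⊆ T → P S → P T) : bprob p A P ≤ bprob q A P :=
  bexp_mono_param h0 hpq h1 fun S T h => by
    have := hP S T h
    split_ifs <;> first | tauto | norm_num

/-- The probability of containing `T` and satisfying a decreasing property: an instance of Harris's
inequality. -/
lemma bprob_superset_and_le (h0 : 0 ≤ p) (h1 : p ≤ 1) {T : Finset α} (hT : T ⊆ A)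
    (hP : ∀ S S', S ⊆ S' → P S' → P S) :
    bprob p A (fun S => T ⊆ S ∧ P S) ≤ p ^ T.card * bprob p A P := by
  classical
  have : bprob p A (fun S => T ⊆ S ∧ P S) =
      bexp p A (fun S => if T ⊆ S then (if P S then 1 else 0) else 0) :=
    bexp_congr fun S _ => by rw [← ite_and]; congr
  rw [this, bexp_superset hT]
  refine mul_le_mul_of_nonneg_left (bprob_mono h0 h1 fun S _ => ?_) (by positivity)
  exact hP S (T ∪ S) Finset.subset_union_right

/-- Upper tail of the binomial distribution, for an arbitrary tilt `s`. -/
lemma bprob_le_card_inter (h0 : 0 ≤ p) (h1 : p ≤ 1) {T : Finset α} (hT : T ⊆ A) {s a : ℝ}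
    (hs : 0 ≤ s) : bprob p A (fun S => a ≤ (S ∩ T).card) ≤
      Real.exp (p * T.card * (Real.exp s - 1) - s * a) := by
  calc bprob p A (fun S => a ≤ (S ∩ T).card)
      ≤ bexp p A (fun S => Real.exp (-(s * a)) * Real.exp s ^ (S ∩ T).card) := by
        refine bprob_le_bexp h0 h1 (fun _ _ => by positivity) fun S _ h => ?_
        rw [← Real.exp_nat_mul, ← Real.exp_add]
        exact Real.one_le_exp (by nlinarith)
    _ ≤ Real.exp (-(s * a)) * Real.exp (p * (Real.exp s - 1)) ^ T.card := by
        rw [bexp_const_mul, bexp_pow_card_inter hT]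
        have : 0 ≤ p * (Real.exp s - 1) := mul_nonneg h0 (by linarith [Real.one_le_exp hs])
        gcongr
        linarith [Real.add_one_le_exp (p * (Real.exp s - 1))]
    _ = _ := by
        rw [← Real.exp_nat_mul, ← Real.exp_add]
        ring_nf

/-- Lower tail of the binomial distribution, for an arbitrary tilt `s`. -/
lemma bprob_card_inter_le (h0 : 0 ≤ p) (h1 : p ≤ 1) {T : Finset α} (hT : T ⊆ A) {s a : ℝ}
    (hs : 0 ≤ s) : bprob p A (fun S => (S ∩ T).card ≤ a) ≤
      Real.exp (p * T.card * (Real.exp (-s) - 1) + s * a) := by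
  calc bprob p A (fun S => (S ∩ T).card ≤ a)
      ≤ bexp p A (fun S => Real.exp (s * a) * Real.exp (-s) ^ (S ∩ T).card) := by
        refine bprob_le_bexp h0 h1 (fun _ _ => by positivity) fun S _ h => ?_
        rw [← Real.exp_nat_mul, ← Real.exp_add]
        exact Real.one_le_exp (by nlinarith)
    _ ≤ Real.exp (s * a) * Real.exp (p * (Real.exp (-s) - 1)) ^ T.card := by
        rw [bexp_const_mul, bexp_pow_card_inter hT]
        have : 0 ≤ 1 + p * (Real.exp (-s) - 1) := by nlinarith [Real.exp_pos (-s)]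
        gcongr
        linarith [Real.add_one_le_exp (p * (Real.exp (-s) - 1))]
    _ = _ := by
        rw [← Real.exp_nat_mul, ← Real.exp_add]
        ring_nf

lemma bprob_disjoint {T : Finset α} (hT : T ⊆ A) :
    bprob p A (fun S => Disjoint S T) = (1 - p) ^ T.card := by
  have := bexp_pow_card_inter (p := p) hT 0
  rw [bprob, show (1 - p) = 1 + p * (0 - 1) by ring, ← this]
  refine bexp_congr fun S _ => ?_
  simp only [zero_pow_eq, Finset.card_eq_zero, Finset.disjoint_iff_inter_eq_empty]

/-! ### Avoiding a family of pairs -/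

variable {ι : Type*} [DecidableEq ι]

lemma bprob_avoid_insert {J : Finset ι} {F : ι → Finset α} {i : ι} (hA : F i ⊆ A)
    (hF : (F i).card = 2) :
    bprob p A (fun S => ∀ j ∈ insert i J, ¬ F j ⊆ S) =
      bprob p A (fun S => ∀ j ∈ J, ¬ F j ⊆ S) -
        p ^ 2 * bprob p A (fun S => ∀ j ∈ J, ¬ F j ⊆ F i ∪ S) := by
  classical
  have h : bexp p A (fun S => if F i ⊆ S then (if ∀ j ∈ J, ¬ F j ⊆ S then 1 else 0) else 0) =
      p ^ 2 * bprob p A (fun S => ∀ j ∈ J, ¬ F j ⊆ F i ∪ S) := by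
    rw [bexp_superset hA, hF, bprob]
    congr!
  rw [← h, bprob, bprob, ← bexp_sub]
  refine bexp_congr fun S _ => ?_
  simp only [Finset.forall_mem_insert]
  split_ifs <;> first | tauto | norm_num

/-- Harris's inequality for pairs: avoiding a family of pairs is at least as likely as if the pairs
were disjoint. -/
lemma le_bprob_avoid (h0 : 0 ≤ p) (h1 : p ≤ 1) (J : Finset ι) {F : ι → Finset α}
    (hA : ∀ i ∈ J, F i ⊆ A) (hF : ∀ i ∈ J, (F i).card = 2) :
    (1 - p ^ 2) ^ J.card ≤ bprob p A (fun S => ∀ i ∈ J, ¬ F i ⊆ S) := by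
  induction J using Finset.induction_on with
  | empty => simp [bprob]
  | insert i J hi ih =>
    rw [Finset.forall_mem_insert] at hA hF
    rw [bprob_avoid_insert hA.1 hF.1, Finset.card_insert_of_notMem hi, pow_succ _ J.card]
    have h2 := ih hA.2 hF.2
    have h3 : bprob p A (fun S => ∀ j ∈ J, ¬ F j ⊆ F i ∪ S) ≤
        bprob p A (fun S => ∀ j ∈ J, ¬ F j ⊆ S) :=
      bprob_mono h0 h1 fun S _ h j hj hS => h j hj (hS.trans Finset.subset_union_right)
    nlinarith [mul_le_mul_of_nonneg_left h3 (sq_nonneg p),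
      mul_le_mul_of_nonneg_right h2 (show 0 ≤ 1 - p ^ 2 by nlinarith)]

/-- Janson's inequality for pairs: if every pair of the family meets at most `d` others, then
avoiding the family is almost as unlikely as if the pairs were disjoint. -/
lemma bprob_avoid_le (h0 : 0 ≤ p) (h1 : p ≤ 1) (J : Finset ι) {F : ι → Finset α}
    (hA : ∀ i ∈ J, F i ⊆ A) (hF : ∀ i ∈ J, (F i).card = 2) (hinj : Set.InjOn F J) {d : ℕ}
    (hd : ∀ i ∈ J, (J.filter fun j => ¬ Disjoint (F i) (F j)).card ≤ d) (hdp : d * p ≤ 1) :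
    bprob p A (fun S => ∀ i ∈ J, ¬ F i ⊆ S) ≤ (1 - p ^ 2 * (1 - d * p)) ^ J.card := by
  classical
  induction J using Finset.induction_on with
  | empty => simp [bprob]
  | insert i J hi ih =>
    have ih' := ih (fun j hj => hA j (Finset.mem_insert_of_mem hj))
      (fun j hj => hF j (Finset.mem_insert_of_mem hj))
      (hinj.mono (by simp)) (fun j hj =>
        (Finset.card_le_card (Finset.filter_subset_filter _ (Finset.subset_insert i J))).trans
          (hd j (Finset.mem_insert_of_mem hj)))
    have hii := Finset.mem_insert_self i J
    rw [bprob_avoid_insert (hA i hii) (hF i hii), Finset.card_insert_of_notMem hi, pow_succ _ J.card]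
    set N := J.filter fun j => ¬ Disjoint (F i) (F j) with hN
    have hNd : N.card ≤ d :=
      (Finset.card_le_card (Finset.filter_subset_filter _ (Finset.subset_insert i J))).trans
        (hd i hii)
    -- `C` avoids only the pairs disjoint from `F i`, hence does not depend on `F i`
    set C : Finset α → Prop := fun S => ∀ j ∈ J, Disjoint (F i) (F j) → ¬ F j ⊆ S with hC
    have hCanti : ∀ S S', S ⊆ S' → C S' → C S := fun S S' h hS j hj hij hjS =>
      hS j hj hij (hjS.trans h)
    have hle : bprob p A (fun S => ∀ j ∈ J, ¬ F j ⊆ S) ≤ bprob p A C :=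
      bprob_mono h0 h1 fun S _ h j hj _ => h j hj
    have hterm : ∀ j ∈ N, bprob p A (fun S => F j \ F i ⊆ S ∧ C S) ≤ p * bprob p A C := by
      intro j hj
      obtain ⟨hjI, -⟩ := Finset.mem_filter.1 hj
      refine (bprob_superset_and_le h0 h1
        (Finset.sdiff_subset.trans (hA j (Finset.mem_insert_of_mem hjI))) hCanti).trans ?_
      refine mul_le_mul_of_nonneg_right ?_ (bprob_nonneg h0 h1)
      have hne : (F j \ F i).card ≠ 0 := by
        rw [Finset.card_ne_zero, Finset.sdiff_nonempty]
        intro hsub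
        have := Finset.eq_of_subset_of_card_le hsub
          (by rw [hF i hii, hF j (Finset.mem_insert_of_mem hjI)])
        exact hi (hinj (Finset.mem_coe.2 (Finset.mem_insert_of_mem hjI))
          (Finset.mem_coe.2 hii) this ▸ hjI)
      exact pow_le_of_le_one h0 h1 hne
    have hlow : (1 - d * p) * bprob p A C ≤ bprob p A (fun S => ∀ j ∈ J, ¬ F j ⊆ F i ∪ S) := by
      have hcover : bprob p A C ≤ bprob p A (fun S => (∀ j ∈ J, ¬ F j ⊆ F i ∪ S) ∨
          ∃ j ∈ N, F j \ F i ⊆ S ∧ C S) := by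
        refine bprob_mono h0 h1 fun S _ hCS => ?_
        by_contra hcon
        push Not at hcon
        obtain ⟨⟨j, hj, hjS⟩, h2⟩ := hcon
        have hjS' : F j \ F i ⊆ S := by
          intro x hx
          have := hjS (Finset.mem_sdiff.1 hx).1
          simp_all
        by_cases hdis : Disjoint (F i) (F j)
        · refine hCS j hj hdis ?_
          rwa [Finset.sdiff_eq_self_of_disjoint hdis.symm] at hjS'
        · exact h2 j (Finset.mem_filter.2 ⟨hj, hdis⟩) hjS' hCS
      have hsum := Finset.sum_le_sum hterm
      rw [Finset.sum_const, nsmul_eq_mul] at hsum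
      have h5 := bprob_or_le (A := A) (P := fun S => ∀ j ∈ J, ¬ F j ⊆ F i ∪ S)
        (Q := fun S => ∃ j ∈ N, F j \ F i ⊆ S ∧ C S) h0 h1
      have h6 := bprob_exists_le (A := A) h0 h1 N (fun j S => F j \ F i ⊆ S ∧ C S)
      have h7 : (N.card : ℝ) * (p * bprob p A C) ≤ d * (p * bprob p A C) :=
        mul_le_mul_of_nonneg_right (by exact_mod_cast hNd)
          (mul_nonneg h0 (bprob_nonneg h0 h1))
      linarith
    have hd1 : 0 ≤ 1 - d * p := by linarith
    have hdp0 : 0 ≤ (d : ℝ) * p := by positivity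
    have h8 := mul_le_mul_of_nonneg_left (hlow.trans' (mul_le_mul_of_nonneg_left hle hd1))
      (sq_nonneg p)
    have h9 : 0 ≤ 1 - p ^ 2 * (1 - d * p) := by nlinarith
    have h10 := mul_le_mul_of_nonneg_right ih' h9
    generalize bprob p A (fun S => ∀ j ∈ J, ¬ F j ⊆ S) = x at *
    generalize bprob p A (fun S => ∀ j ∈ J, ¬ F j ⊆ F i ∪ S) = y at *
    linarith

end RandomSubset

/-! ### Graphs without NAC-colourings -/

section Deterministic

variable {V : Type*} {G : SimpleGraph V}

/-- Two large sets of vertices are always joined by an edge, and every small nonempty set `U` has a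
vertex that forms a triangle with two vertices outside `U`. Here a set is large if it has at least
`κ` elements, and small if it has at most `2 * κ`. -/
structure IsMixing [Fintype V] [DecidableEq V] (κ : ℝ) (G : SimpleGraph V) : Prop where
  exists_adj : ∀ A B : Finset V, Disjoint A B → κ ≤ A.card → κ ≤ B.card →
    ∃ a ∈ A, ∃ b ∈ B, G.Adj a b
  exists_triangle : ∀ U : Finset V, U.Nonempty → (U.card : ℝ) ≤ 2 * κ →
    ∃ u ∈ U, ∃ y, y ∉ U ∧ ∃ z, z ∉ U ∧ G.Adj u y ∧ G.Adj u z ∧ G.Adj y z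

section Finite

variable [Fintype V] [DecidableEq V] {κ : ℝ}

lemma IsMixing.mono {G' : SimpleGraph V} (h : IsMixing κ G) (hle : G ≤ G') : IsMixing κ G' where
  exists_adj A B hAB hA hB := by
    obtain ⟨a, ha, b, hb, hab⟩ := h.exists_adj A B hAB hA hB
    exact ⟨a, ha, b, hb, hle hab⟩
  exists_triangle U hU hUκ := by
    obtain ⟨u, hu, y, hy, z, hz, h1, h2, h3⟩ := h.exists_triangle U hU hUκ
    exact ⟨u, hu, y, hy, z, hz, hle h1, hle h2, hle h3⟩

lemma card_add_card_compl_real (S : Finset V) :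
    (S.card : ℝ) + (Sᶜ.card : ℝ) = Fintype.card V := by
  exact_mod_cast Finset.card_add_card_compl S

lemma IsMixing.connected (h : IsMixing κ G) (hκ : 0 < κ) (hn : 2 * κ < Fintype.card V) :
    G.Connected := by
  classical
  have hne : Nonempty V := by
    by_contra hV
    rw [not_nonempty_iff] at hV
    rw [Fintype.card_eq_zero] at hn
    push_cast at hn
    linarith
  refine ⟨fun u v => ?_⟩
  by_contra huv
  set A : Finset V := Finset.univ.filter fun x => G.Reachable u x with hA
  have hadj : ∀ a b, G.Adj a b → (a ∈ A ↔ b ∈ A) := by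
    intro a b hab
    simp only [hA, Finset.mem_filter, Finset.mem_univ, true_and]
    exact ⟨fun h => h.trans hab.reachable, fun h => h.trans hab.symm.reachable⟩
  have hsmall : ∀ U : Finset V, U.Nonempty → (∀ a b, G.Adj a b → (a ∈ U ↔ b ∈ U)) →
      2 * κ < U.card := by
    intro U hU hUadj
    by_contra hcard
    obtain ⟨x, hx, y, hy, -, -, hxy, -⟩ := h.exists_triangle U hU (not_lt.1 hcard)
    exact hy ((hUadj x y hxy).1 hx)
  have h1 := hsmall A ⟨u, by simp [hA]⟩ hadj
  have h2 := hsmall Aᶜ ⟨v, by simp [hA, huv]⟩ fun a b hab => by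
    simp only [Finset.mem_compl, hadj a b hab]
  obtain ⟨a, ha, b, hb, hab⟩ := h.exists_adj A Aᶜ disjoint_compl_right (by linarith) (by linarith)
  exact Finset.mem_compl.1 hb ((hadj a b hab).1 ha)

/-- An equivalence relation on a large set either has a union of classes that splits the set into
two large parts, or a class that contains almost everything. -/
lemma exists_saturated_or_class (r : Setoid V) (hκ : 0 < κ) (hn : 6 * κ < Fintype.card V) :
    (∃ A : Finset V, (∀ x y, r x y → (x ∈ A ↔ y ∈ A)) ∧ 2 * κ < A.card ∧ 2 * κ < Aᶜ.card) ∨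
    ∃ C : Finset V, (∀ x ∈ C, ∀ y, r x y ↔ y ∈ C) ∧ (Cᶜ.card : ℝ) ≤ 2 * κ := by
  classical
  by_contra hcon
  push Not at hcon
  obtain ⟨hsat, hclass⟩ := hcon
  -- a minimal saturated set with more than `2 * κ` elements
  obtain ⟨A, hA⟩ := (Set.toFinite {A : Finset V | (∀ x y, r x y → (x ∈ A ↔ y ∈ A)) ∧
    2 * κ < A.card}).exists_minimal ⟨Finset.univ, by
      constructor
      · simp
      · rw [Finset.card_univ]; linarith⟩
  obtain ⟨⟨hAr, hAc⟩, hAmin⟩ := hA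
  have hApos : A.Nonempty := by
    rw [← Finset.card_pos]
    have : (0 : ℝ) < A.card := by linarith
    exact_mod_cast this
  obtain ⟨x, hx⟩ := hApos
  set C : Finset V := Finset.univ.filter fun y => r x y with hC
  have hCr : ∀ a b, r a b → (a ∈ C ↔ b ∈ C) := by
    intro a b hab
    simp only [hC, Finset.mem_filter, Finset.mem_univ, true_and]
    exact ⟨fun h => r.trans h hab, fun h => r.trans h (r.symm hab)⟩
  have hCA : C ⊆ A := fun y hy => (hAr x y (by simpa [hC] using hy)).1 hx
  have hCcard : (C.card : ℝ) ≤ 2 * κ := by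
    by_contra hlt
    refine absurd (hsat C hCr (not_le.1 hlt)) (not_le.2 (hclass C fun a ha b => ?_))
    have hxa : r x a := by simpa [hC] using ha
    simp only [hC, Finset.mem_filter, Finset.mem_univ, true_and]
    exact ⟨fun h => r.trans hxa h, fun h => r.trans (r.symm hxa) h⟩
  have hrest : ((A \ C).card : ℝ) ≤ 2 * κ := by
    by_contra hlt
    have hmem : x ∈ A \ C := by
      refine hAmin ⟨fun a b hab => ?_, not_le.1 hlt⟩ Finset.sdiff_subset hx
      simp only [Finset.mem_sdiff, hAr a b hab, hCr a b hab]
    exact (Finset.mem_sdiff.1 hmem).2 (by simp [hC])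
  have hsum : ((A \ C).card : ℝ) + C.card = A.card := by
    exact_mod_cast Finset.card_sdiff_add_card_eq_card hCA
  have := hsat A hAr hAc
  have := card_add_card_compl_real A
  linarith

/-- If every edge joins two `r`-equivalent or two `b`-equivalent vertices, but not both, then no
class of `r` contains almost all vertices. -/
lemma IsMixing.not_exists_class (h : IsMixing κ G) {r b : Setoid V}
    (hor : ∀ x y, G.Adj x y → r x y ∨ b x y) (hand : ∀ x y, G.Adj x y → r x y → ¬ b x y)
    (hr : ∃ x y, ¬ r x y) :
    ¬ ∃ C : Finset V, (∀ x ∈ C, ∀ y, r x y ↔ y ∈ C) ∧ (Cᶜ.card : ℝ) ≤ 2 * κ := by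
  rintro ⟨C, hC, hcard⟩
  have hne : Cᶜ.Nonempty := by
    obtain ⟨x, y, hxy⟩ := hr
    by_contra hemp
    rw [Finset.not_nonempty_iff_eq_empty, Finset.compl_eq_empty_iff] at hemp
    exact hxy ((hC x (by simp [hemp]) y).2 (by simp [hemp]))
  obtain ⟨u, hu, y, hy, z, hz, huy, huz, hyz⟩ := h.exists_triangle Cᶜ hne hcard
  rw [Finset.mem_compl] at hu
  rw [Finset.notMem_compl] at hy hz
  have hby : b u y := (hor u y huy).resolve_left fun hr => hu ((hC y hy u).1 (r.symm hr))
  have hbz : b u z := (hor u z huz).resolve_left fun hr => hu ((hC z hz u).1 (r.symm hr))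
  exact hand y z hyz ((hC y hy z).2 hz) (b.trans (b.symm hby) hbz)

/-- In a mixing graph, the edges cannot be distributed over two nontrivial equivalence relations. -/
lemma IsMixing.not_exists_setoid (h : IsMixing κ G) (hκ : 0 < κ) (hn : 6 * κ < Fintype.card V)
    {r b : Setoid V} (hor : ∀ x y, G.Adj x y → r x y ∨ b x y)
    (hand : ∀ x y, G.Adj x y → r x y → ¬ b x y) (hr : ∃ x y, ¬ r x y) (hb : ∃ x y, ¬ b x y) :
    False := by
  obtain ⟨R, hR, hR1, hR2⟩ := (exists_saturated_or_class r hκ hn).resolve_right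
    (h.not_exists_class hor hand hr)
  obtain ⟨B, hB, hB1, hB2⟩ := (exists_saturated_or_class b hκ hn).resolve_right
    (h.not_exists_class (fun x y hxy => (hor x y hxy).symm)
      (fun x y hxy h1 h2 => hand x y hxy h2 h1) hb)
  -- opposite quarters of the partition by `R` and `B` are not joined by edges
  have key : ∀ B' : Finset V, (∀ x y, b x y → (x ∈ B' ↔ y ∈ B')) →
      ((R ∩ B').card : ℝ) < κ ∨ ((Rᶜ ∩ B'ᶜ).card : ℝ) < κ := by
    intro B' hB'
    by_contra hcon
    push Not at hcon
    obtain ⟨x, hx, y, hy, hxy⟩ := h.exists_adj (R ∩ B') (Rᶜ ∩ B'ᶜ)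
      (disjoint_compl_right.mono Finset.inter_subset_left Finset.inter_subset_left) hcon.1 hcon.2
    simp only [Finset.mem_inter, Finset.mem_compl] at hx hy
    rcases hor x y hxy with h1 | h1
    · exact hy.1 ((hR x y h1).1 hx.1)
    · exact hy.2 ((hB' x y h1).1 hx.2)
  have k1 := key B hB
  have k2 := key Bᶜ fun x y hxy => by simp only [Finset.mem_compl, hB x y hxy]
  rw [compl_compl] at k2
  have hcard (S T : Finset V) : ((S ∩ T).card : ℝ) + (S ∩ Tᶜ).card = S.card := by
    rw [← Finset.sdiff_eq_inter_compl, add_comm]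
    exact_mod_cast Finset.card_sdiff_add_card_inter S T
  have c1 := hcard R B
  have c2 := hcard Rᶜ B
  have c3 := hcard B R
  have c4 := hcard Bᶜ R
  rw [Finset.inter_comm B, Finset.inter_comm B] at c3
  rw [Finset.inter_comm Bᶜ, Finset.inter_comm Bᶜ] at c4
  rcases k1 with k1 | k1 <;> rcases k2 with k2 | k2 <;> linarith

end Finite

/-! ### Monochromatic components -/

/-- The spanning subgraph of the edges of colour `x`. -/
def colourGraph (c : G.edgeSet → EdgeColour) (x : EdgeColour) : SimpleGraph V :=
  SimpleGraph.fromEdgeSet {e | ∃ h : e ∈ G.edgeSet, c ⟨e, h⟩ = x}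

lemma colourGraph_adj {c : G.edgeSet → EdgeColour} {x : EdgeColour} {u v : V} :
    (colourGraph c x).Adj u v ↔ ∃ h : s(u, v) ∈ G.edgeSet, c ⟨s(u, v), h⟩ = x := by
  simp only [colourGraph, SimpleGraph.fromEdgeSet_adj, Set.mem_ofPred_eq]
  exact ⟨fun h => h.1, fun h => ⟨h, by rintro rfl; simpa using h.1⟩⟩

/-- In a NAC-colouring no edge joins two vertices of a component of the other colour. -/
lemma IsNACColouring.colour_eq_of_reachable {c : G.edgeSet → EdgeColour} (hc : IsNACColouring G c)
    {x : EdgeColour} {u v : V} (huv : (colourGraph c x).Reachable u v)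
    (h : s(u, v) ∈ G.edgeSet) : c ⟨s(u, v), h⟩ = x := by
  classical
  by_contra hne
  have hle : colourGraph c x ≤ G := fun a b hab => (colourGraph_adj.1 hab).1
  obtain ⟨w, hw⟩ := huv.exists_isPath
  have hcol : ∀ e ∈ (w.mapLe hle).edges, ∃ h : e ∈ G.edgeSet, c ⟨e, h⟩ = x := by
    intro e he
    rw [SimpleGraph.Walk.edges_mapLe_eq_edges] at he
    have := w.edges_subset_edgeSet he
    induction e with
    | h a b => exact colourGraph_adj.1 this
  have hvu : G.Adj v u := (SimpleGraph.mem_edgeSet G).1 (Sym2.eq_swap ▸ h)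
  have hnot : s(v, u) ∉ (w.mapLe hle).edges := by
    intro hmem
    rw [Sym2.eq_swap] at hmem
    exact hne (hcol _ hmem).2
  have hcyc := SimpleGraph.Path.cons_isCycle ⟨w.mapLe hle, hw.mapLe hle⟩ hvu hnot
  have huniq : ∀ y, c ⟨s(u, v), h⟩ = y → y ≠ x → ∃! e : G.edgeSet,
      (e : Sym2 V) ∈ (SimpleGraph.Walk.cons hvu (w.mapLe hle)).edges ∧ c e = y := by
    intro y hy hyx
    refine ⟨⟨s(u, v), h⟩, ⟨by simp [Sym2.eq_swap], hy⟩, ?_⟩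
    rintro ⟨e, he⟩ ⟨hmem, hey⟩
    rw [SimpleGraph.Walk.edges_cons, List.mem_cons] at hmem
    rcases hmem with rfl | hmem
    · exact Subtype.ext Sym2.eq_swap
    · exact absurd (hey.symm.trans (hcol e hmem).2) hyx
  obtain ⟨hred, hblue⟩ := hc.2 v _ hcyc
  cases hy : c ⟨s(u, v), h⟩ with
  | red => exact hred (huniq _ hy fun h => hne (hy.trans h))
  | blue => exact hblue (huniq _ hy fun h => hne (hy.trans h))

/-- A mixing graph is connected and has no NAC-colouring: the red and the blue components of a
NAC-colouring would distribute the edges over two nontrivial equivalence relations. -/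
theorem IsMixing.connectedNoNAC [Fintype V] [DecidableEq V] {κ : ℝ} (h : IsMixing κ G)
    (hκ : 0 < κ) (hn : 6 * κ < Fintype.card V) : ConnectedNoNAC G := by
  refine ⟨h.connected hκ (by linarith), ?_⟩
  rintro ⟨c, hc⟩
  have hne {x y : EdgeColour} (hxy : x ≠ y) :
      ∃ u v, ¬ (colourGraph c x).reachableSetoid u v := by
    obtain ⟨⟨e, he⟩, hey⟩ := hc.1 y
    induction e with
    | h u v =>
      exact ⟨u, v, fun huv => hxy ((hc.colour_eq_of_reachable huv he).symm.trans hey)⟩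
  refine h.not_exists_setoid hκ hn (r := (colourGraph c .red).reachableSetoid)
    (b := (colourGraph c .blue).reachableSetoid) ?_ ?_ (hne (y := .blue) (by simp))
    (hne (y := .red) (by simp))
  · intro u v huv
    cases hcol : c ⟨s(u, v), huv⟩ with
    | red => exact Or.inl (colourGraph_adj.2 ⟨huv, hcol⟩).reachable
    | blue => exact Or.inr (colourGraph_adj.2 ⟨huv, hcol⟩).reachable
  · intro u v huv hr hb
    have h1 := hc.colour_eq_of_reachable hr huv
    have h2 := hc.colour_eq_of_reachable hb huv
    exact EdgeColour.noConfusion (h1.symm.trans h2)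

/-! ### A vertex in no triangle gives a NAC-colouring -/

lemma exists_other_edge_of_isCycle {u x y : V} {w : G.Walk u u} (hw : w.IsCycle)
    (h : s(x, y) ∈ w.edges) : ∃ z, z ≠ y ∧ s(x, z) ∈ w.edges := by
  have h2 := hw.ncard_neighborSet_toSubgraph_eq_two (w.fst_mem_support_of_mem_edges h)
  obtain ⟨z, hz, hzy⟩ := Set.exists_ne_of_one_lt_ncard (by rw [h2]; norm_num) y
  refine ⟨z, hzy, ?_⟩
  rwa [SimpleGraph.Subgraph.mem_neighborSet, ← SimpleGraph.Subgraph.mem_edgeSet,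
    SimpleGraph.Walk.mem_edges_toSubgraph] at hz

/-- If `v` is in no triangle, then colouring the edges at `v` red and all other edges blue leaves no
cycle with exactly one edge of some colour. -/
lemma not_exists_unique_of_no_triangle {v : V}
    (hv : ∀ x y, G.Adj v x → G.Adj v y → ¬ G.Adj x y)
    {c : G.edgeSet → EdgeColour} (hc : ∀ e, c e = EdgeColour.red ↔ v ∈ (e : Sym2 V)) {u : V}
    {w : G.Walk u u} (hw : w.IsCycle) :
    (¬ ∃! e : G.edgeSet, (e : Sym2 V) ∈ w.edges ∧ c e = EdgeColour.red) ∧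
      (¬ ∃! e : G.edgeSet, (e : Sym2 V) ∈ w.edges ∧ c e = EdgeColour.blue) := by
  constructor
  · rintro ⟨⟨e, he⟩, ⟨hew, hered⟩, huniq⟩
    obtain ⟨x, rfl⟩ := Sym2.mem_iff_exists.1 ((hc _).1 hered)
    obtain ⟨z, hz, hzw⟩ := exists_other_edge_of_isCycle hw hew
    have := huniq ⟨s(v, z), w.edges_subset_edgeSet hzw⟩ ⟨hzw, (hc _).2 (Sym2.mem_mk_left v z)⟩
    rw [Subtype.mk.injEq, Sym2.congr_right] at this
    exact hz this
  · rintro ⟨⟨e, he⟩, ⟨hew, heblue⟩, huniq⟩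
    have hve : v ∉ e := fun h => by
      rw [(hc ⟨e, he⟩).2 h] at heblue
      exact EdgeColour.noConfusion heblue
    -- the neighbouring edges on the cycle are red, hence lead to `v`
    have hnext : ∀ x y, e = s(x, y) → G.Adj v x := by
      rintro x y rfl
      obtain ⟨z, hz, hzw⟩ := exists_other_edge_of_isCycle hw hew
      have hzG := w.edges_subset_edgeSet hzw
      have hred : c ⟨s(x, z), hzG⟩ = EdgeColour.red := by
        cases hcol : c ⟨s(x, z), hzG⟩ with
        | red => rfl
        | blue =>
          have := huniq ⟨s(x, z), hzG⟩ ⟨hzw, hcol⟩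
          rw [Subtype.mk.injEq, Sym2.congr_right] at this
          exact absurd this hz
      have hvm := (hc _).1 hred
      rw [Sym2.mem_iff] at hvm
      rcases hvm with rfl | rfl
      · exact absurd (Sym2.mem_mk_left _ _) hve
      · exact SimpleGraph.Adj.symm hzG
    induction e with
    | h x y => exact hv x y (hnext x y rfl) (hnext y x Sym2.eq_swap) he

open Classical in
/-- A connected graph on at least three vertices with a vertex in no triangle has a NAC-colouring:
colour the edges at that vertex red and the others blue, or, if the graph is a star, colour
arbitrarily. -/
theorem exists_isNACColouring_of_no_triangle [Fintype V] (hG : G.Connected)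
    (hn : 3 ≤ Fintype.card V) {v : V} (hv : ∀ x y, G.Adj v x → G.Adj v y → ¬ G.Adj x y) :
    ∃ c : G.edgeSet → EdgeColour, IsNACColouring G c := by
  have hnontriv : Nontrivial V := Fintype.one_lt_card_iff_nontrivial.1 (by omega)
  obtain ⟨a, hva⟩ := hG.preconnected.exists_adj_of_nontrivial v
  by_cases hstar : ∀ e ∈ G.edgeSet, v ∈ e
  · obtain ⟨b, hb⟩ : ∃ b, b ∉ ({v, a} : Finset V) := by
      by_contra hcon
      push Not at hcon
      have := Finset.card_le_card (fun x _ => hcon x : Finset.univ ⊆ ({v, a} : Finset V))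
      rw [Finset.card_univ] at this
      have := Finset.card_le_two (a := v) (b := a)
      omega
    simp only [Finset.mem_insert, Finset.mem_singleton, not_or] at hb
    have hvb : G.Adj v b := by
      obtain ⟨y, hy⟩ := hG.preconnected.exists_adj_of_nontrivial b
      have := hstar s(b, y) hy
      rw [Sym2.mem_iff] at this
      rcases this with rfl | rfl
      · exact absurd rfl hb.1
      · exact hy.symm
    refine ⟨fun e => if (e : Sym2 V) = s(v, a) then .red else .blue, ?_, ?_⟩
    · rintro (_ | _)
      · exact ⟨⟨s(v, a), hva⟩, by simp⟩
      · exact ⟨⟨s(v, b), hvb⟩, by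
          simp only [Sym2.congr_right, hb.2, if_false]⟩
    · -- a star contains no cycle
      intro u w hw
      exfalso
      have hne : w.edges ≠ [] := by
        intro h
        exact hw.not_nil (SimpleGraph.Walk.edges_eq_nil.1 h)
      obtain ⟨e, he⟩ := List.exists_mem_of_ne_nil _ hne
      obtain ⟨x, rfl⟩ := Sym2.mem_iff_exists.1 (hstar e (w.edges_subset_edgeSet he))
      have hvx : v ≠ x := (w.edges_subset_edgeSet he : G.Adj v x).ne
      rw [Sym2.eq_swap] at he
      obtain ⟨z, hz, hzw⟩ := exists_other_edge_of_isCycle hw he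
      have := hstar _ (w.edges_subset_edgeSet hzw)
      rw [Sym2.mem_iff] at this
      tauto
  · push Not at hstar
    obtain ⟨e, he, hve⟩ := hstar
    refine ⟨fun e => if v ∈ (e : Sym2 V) then .red else .blue, ?_, ?_⟩
    · rintro (_ | _)
      · exact ⟨⟨s(v, a), hva⟩, by simp⟩
      · exact ⟨⟨e, he⟩, by simp [hve]⟩
    · intro u w hw
      refine not_exists_unique_of_no_triangle hv (fun e => ?_) hw
      split_ifs with h <;> simp [h]

end Deterministic

/-! ### The binomial random graph as a random set of pairs -/

section RandomGraph

variable {V : Type*} [DecidableEq V]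

/-- The pairs joining `u` to an end of `e`. -/
def spokes (u : V) (e : Sym2 V) : Finset (Sym2 V) := e.toFinset.image fun x => s(u, x)

lemma spokes_mk (u x y : V) : spokes u s(x, y) = {s(u, x), s(u, y)} := by
  simp [spokes, Sym2.toFinset_mk_eq, Finset.image_insert]

lemma card_spokes (u : V) {e : Sym2 V} (he : ¬ e.IsDiag) : (spokes u e).card = 2 := by
  rw [spokes, Finset.card_image_of_injective _ fun x y h => Sym2.congr_right.1 h,
    Sym2.card_toFinset_of_not_isDiag e he]

lemma spokes_injective (u : V) : Function.Injective (spokes u) := by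
  intro e e' h
  have h2 : e.toFinset = e'.toFinset :=
    Finset.image_injective (fun x y h => Sym2.congr_right.1 h) h
  ext x
  rw [← Sym2.mem_toFinset, h2, Sym2.mem_toFinset]

lemma mem_spokes {u : V} {e f : Sym2 V} : f ∈ spokes u e ↔ ∃ x ∈ e, s(u, x) = f := by
  simp [spokes]

variable [Fintype V]

variable (V) in
/-- The pairs of distinct vertices. -/
def vertexPairs : Finset (Sym2 V) := Finset.univ.filter fun e => ¬ e.IsDiag

/-- The pairs of distinct vertices contained in `W`. -/
def pairsIn (W : Finset V) : Finset (Sym2 V) := (vertexPairs V).filter fun e => ∀ x ∈ e, x ∈ W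

/-- The pairs of distinct vertices that contain `x`. -/
def pairsAt (x : V) : Finset (Sym2 V) := (vertexPairs V).filter fun e => x ∈ e

lemma mk_mem_vertexPairs {x y : V} : s(x, y) ∈ vertexPairs V ↔ x ≠ y := by
  simp [vertexPairs]

lemma pairsIn_subset (W : Finset V) : pairsIn W ⊆ vertexPairs V := Finset.filter_subset _ _

lemma pairsAt_subset (x : V) : pairsAt x ⊆ vertexPairs V := Finset.filter_subset _ _

lemma mk_mem_pairsIn {W : Finset V} {x y : V} : s(x, y) ∈ pairsIn W ↔ x ≠ y ∧ x ∈ W ∧ y ∈ W := by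
  simp [pairsIn, mk_mem_vertexPairs]

lemma card_vertexPairs : (vertexPairs V).card = (Fintype.card V).choose 2 := by
  rw [← Sym2.card_subtype_not_diag, Fintype.card_subtype, vertexPairs]

lemma card_pairsAt_le (x : V) : (pairsAt x).card ≤ Fintype.card V := by
  have : pairsAt x ⊆ Finset.univ.image fun y => s(x, y) := by
    intro e he
    obtain ⟨y, rfl⟩ := Sym2.mem_iff_exists.1 (Finset.mem_filter.1 he).2
    simp
  exact (Finset.card_le_card this).trans Finset.card_image_le

theorem binomialRandom_apply_eq_bprob (p : I) (P : SimpleGraph V → Prop) :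
    SimpleGraph.binomialRandom V p {G | P G} =
      ENNReal.ofReal (bprob p (vertexPairs V) fun S => P (SimpleGraph.fromEdgeSet S)) := by
  classical
  have hsing : MeasurableSingletonClass (SimpleGraph V) := by
    refine ⟨fun G => ?_⟩
    have : {G} = SimpleGraph.edgeSet ⁻¹' {G.edgeSet} := by ext; simp
    rw [this]
    exact SimpleGraph.measurable_edgeSet (measurableSet_singleton _)
  have hterm (G : SimpleGraph V) : (SimpleGraph.binomialRandom V p).real {G} =
      (p : ℝ) ^ G.edgeFinset.card * (1 - p : ℝ) ^ (vertexPairs V \ G.edgeFinset).card := by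
    have hsub : G.edgeFinset ⊆ vertexPairs V := fun e he => by
      simpa [vertexPairs] using G.not_isDiag_of_mem_edgeFinset he
    rw [measureReal_def, SimpleGraph.binomialRandom_singleton, Finset.card_sdiff_of_subset hsub,
      card_vertexPairs, Nat.card_eq_fintype_card, ← SimpleGraph.coe_edgeFinset,
      Set.ncard_coe_finset]
    simp
  have hfin : SimpleGraph.binomialRandom V p {G | P G} =
      ENNReal.ofReal (∑ G ∈ Finset.univ.filter P, (SimpleGraph.binomialRandom V p).real {G}) := by
    rw [sum_measureReal_singleton, ofReal_measureReal]
    simp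
  rw [hfin, bprob, bexp, Finset.sum_filter]
  congr 1
  refine Finset.sum_bij' (fun G _ => G.edgeFinset) (fun S _ => SimpleGraph.fromEdgeSet S)
    ?_ ?_ ?_ ?_ ?_
  · intro G _
    rw [Finset.mem_powerset]
    intro e he
    simpa [vertexPairs] using G.not_isDiag_of_mem_edgeFinset he
  · simp
  · simp
  · intro S hS
    rw [Finset.mem_powerset] at hS
    ext e
    simp only [SimpleGraph.mem_edgeFinset, SimpleGraph.edgeSet_fromEdgeSet, Set.mem_sdiff,
      Finset.mem_coe]
    refine ⟨fun h => h.1, fun h => ⟨h, ?_⟩⟩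
    simpa [vertexPairs] using hS h
  · intro G _
    rw [hterm]
    simp

variable {p : ℝ}

lemma spokes_subset {W : Finset V} {u : V} (hu : u ∉ W) {e : Sym2 V} (he : e ∈ pairsIn W) :
    spokes u e ⊆ vertexPairs V \ pairsIn W := by
  intro f hf
  obtain ⟨x, hx, rfl⟩ := mem_spokes.1 hf
  have hxW : x ∈ W := (Finset.mem_filter.1 he).2 x hx
  rw [Finset.mem_sdiff, mk_mem_vertexPairs, mk_mem_pairsIn]
  exact ⟨fun h => hu (h ▸ hxW), fun h => hu h.2.1⟩

lemma not_isDiag_of_mem_pairsIn {W : Finset V} {e : Sym2 V} (he : e ∈ pairsIn W) : ¬ e.IsDiag :=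
  (Finset.mem_filter.1 (pairsIn_subset W he)).2

end RandomGraph

/-! ### Mixing is likely above the threshold -/

section Upper

variable {V : Type*} [Fintype V] [DecidableEq V] {p : ℝ}

/-- No vertex of `U` has two neighbours outside `U` that are joined by an edge. -/
def IsIsolated (U : Finset V) (S : Finset (Sym2 V)) : Prop :=
  ∀ u ∈ U, ∀ y ∉ U, ∀ z ∉ U, s(u, y) ∈ S → s(u, z) ∈ S → s(y, z) ∉ S

/-- Given the graph `H` outside `U`, Janson's inequality for the triangles with one vertex in `U`
and an edge in `H`. -/
lemma bprob_isIsolated_union_le (h0 : 0 ≤ p) (h1 : p ≤ 1) (U : Finset V) {H : Finset (Sym2 V)}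
    (hH : H ⊆ pairsIn Uᶜ) {D : ℕ} (hD : ∀ x, (H ∩ pairsAt x).card ≤ D) (hDp : 2 * D * p ≤ 1) :
    bprob p (vertexPairs V \ pairsIn Uᶜ) (fun T => IsIsolated U (H ∪ T)) ≤
      (1 - p ^ 2 * (1 - 2 * D * p)) ^ (U.card * H.card) := by
  set F : V × Sym2 V → Finset (Sym2 V) := fun i => spokes i.1 i.2 with hF
  have hmem {i : V × Sym2 V} (hi : i ∈ U ×ˢ H) : i.1 ∈ U ∧ i.2 ∈ pairsIn Uᶜ :=
    ⟨(Finset.mem_product.1 hi).1, hH (Finset.mem_product.1 hi).2⟩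
  -- a pair common to `spokes u e` and `spokes u' e'` determines the end in `U`
  have hcommon {i j : V × Sym2 V} (hi : i ∈ U ×ˢ H) (hj : j ∈ U ×ˢ H) {f : Sym2 V}
      (hfi : f ∈ F i) (hfj : f ∈ F j) : j.1 = i.1 ∧ ∃ x ∈ i.2, x ∈ j.2 := by
    obtain ⟨x, hx, rfl⟩ := mem_spokes.1 hfi
    obtain ⟨y, hy, hxy⟩ := mem_spokes.1 hfj
    have hxU := (Finset.mem_filter.1 (hmem hi).2).2 x hx
    rw [Finset.mem_compl] at hxU
    rw [Sym2.eq_iff] at hxy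
    rcases hxy with ⟨h, rfl⟩ | ⟨h, -⟩
    · exact ⟨h, y, hx, hy⟩
    · exact absurd (h ▸ (hmem hj).1) hxU
  have hcard {i : V × Sym2 V} (hi : i ∈ U ×ˢ H) : (F i).card = 2 :=
    card_spokes _ (not_isDiag_of_mem_pairsIn (hmem hi).2)
  calc bprob p (vertexPairs V \ pairsIn Uᶜ) (fun T => IsIsolated U (H ∪ T))
      ≤ bprob p (vertexPairs V \ pairsIn Uᶜ) (fun T => ∀ i ∈ U ×ˢ H, ¬ F i ⊆ T) := by
        refine bprob_mono h0 h1 fun T _ hT i hi hiT => ?_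
        obtain ⟨u, e⟩ := i
        have heH : e ∈ H := (Finset.mem_product.1 hi).2
        have heU := (hmem hi).2
        induction e with
        | h y z =>
          rw [mk_mem_pairsIn, Finset.mem_compl, Finset.mem_compl] at heU
          simp only [hF, spokes_mk, Finset.insert_subset_iff, Finset.singleton_subset_iff] at hiT
          exact hT u (hmem hi).1 y heU.2.1 z heU.2.2 (Finset.mem_union_right _ hiT.1)
            (Finset.mem_union_right _ hiT.2) (Finset.mem_union_left _ heH)
    _ ≤ (1 - p ^ 2 * (1 - (2 * D : ℕ) * p)) ^ (U ×ˢ H).card := by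
        refine bprob_avoid_le h0 h1 _ (fun i hi => spokes_subset (by simpa using (hmem hi).1)
          (hmem hi).2) (fun i hi => hcard hi) ?_ ?_ (by push_cast; exact hDp)
        · rintro ⟨u, e⟩ hi ⟨u', e'⟩ hj hij
          rw [Finset.mem_coe] at hi hj
          replace hij : F (u, e) = F (u', e') := hij
          obtain ⟨f, hf⟩ : (F (u, e)).Nonempty := by
            rw [← Finset.card_pos, hcard hi]; norm_num
          obtain rfl : u' = u := (hcommon hi hj hf (hij ▸ hf)).1
          have : e = e' := spokes_injective u' hij
          rw [this]
        · rintro ⟨u, e⟩ hi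
          induction e with
          | h y z =>
            have hsub : (U ×ˢ H).filter (fun j => ¬ Disjoint (F (u, s(y, z))) (F j)) ⊆
                {u} ×ˢ ((H ∩ pairsAt y) ∪ (H ∩ pairsAt z)) := by
              rintro ⟨u', e'⟩ hj
              obtain ⟨hj, hdis⟩ := Finset.mem_filter.1 hj
              obtain ⟨f, hf, hf'⟩ := Finset.not_disjoint_iff.1 hdis
              obtain ⟨hu, x, hx, hx'⟩ := hcommon hi hj hf hf'
              have heH : e' ∈ H := (Finset.mem_product.1 hj).2
              have hat : e' ∈ pairsAt x :=
                Finset.mem_filter.2 ⟨pairsIn_subset _ (hH heH), hx'⟩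
              rw [Finset.mem_product, Finset.mem_singleton, Finset.mem_union, Finset.mem_inter,
                Finset.mem_inter]
              refine ⟨hu, ?_⟩
              rcases Sym2.mem_iff.1 hx with rfl | rfl
              · exact Or.inl ⟨heH, hat⟩
              · exact Or.inr ⟨heH, hat⟩
            refine (Finset.card_le_card hsub).trans ?_
            rw [Finset.card_product, Finset.card_singleton, one_mul, two_mul]
            exact (Finset.card_union_le _ _).trans (add_le_add (hD y) (hD z))
    _ = _ := by rw [Finset.card_product]; push_cast; rfl

/-- For a fixed set `U`, it is unlikely that the graph has many edges and small degrees, and `U` is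
isolated. -/
lemma bprob_isIsolated_and_le (h0 : 0 ≤ p) (h1 : p ≤ 1) (U : Finset V) {D : ℕ} {a b : ℝ}
    (hDp : 2 * D * p ≤ 1) (hab : b ≤ a - U.card * D) :
    bprob p (vertexPairs V) (fun S => (a ≤ S.card ∧ ∀ x, (S ∩ pairsAt x).card ≤ D) ∧
      IsIsolated U S) ≤ Real.exp (-(p ^ 2 * (1 - 2 * D * p) * b)) ^ U.card := by
  have hunion : vertexPairs V = pairsIn Uᶜ ∪ (vertexPairs V \ pairsIn Uᶜ) :=
    (Finset.union_sdiff_of_subset (pairsIn_subset _)).symm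
  rw [hunion]
  refine bprob_union_le h0 h1 Finset.disjoint_sdiff fun H hH => ?_
  by_cases hgood : (∀ x, (H ∩ pairsAt x).card ≤ D) ∧ b ≤ H.card
  · have hx0 : 0 ≤ 1 - 2 * D * p := by linarith
    have hx1 : p ^ 2 * (1 - 2 * D * p) ≤ 1 := by
      have : 0 ≤ 2 * (D : ℝ) * p := by positivity
      nlinarith
    calc bprob p (vertexPairs V \ pairsIn Uᶜ) (fun T => (a ≤ (H ∪ T).card ∧
          ∀ x, ((H ∪ T) ∩ pairsAt x).card ≤ D) ∧ IsIsolated U (H ∪ T))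
        ≤ bprob p (vertexPairs V \ pairsIn Uᶜ) (fun T => IsIsolated U (H ∪ T)) :=
          bprob_mono h0 h1 fun T _ h => h.2
      _ ≤ (1 - p ^ 2 * (1 - 2 * D * p)) ^ (U.card * H.card) :=
          bprob_isIsolated_union_le h0 h1 U hH hgood.1 hDp
      _ ≤ Real.exp (-(p ^ 2 * (1 - 2 * D * p))) ^ (U.card * H.card) := by
          refine pow_le_pow_left₀ (by linarith) ?_ _
          linarith [Real.add_one_le_exp (-(p ^ 2 * (1 - 2 * D * p)))]
      _ = (Real.exp (-(p ^ 2 * (1 - 2 * D * p))) ^ H.card) ^ U.card := by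
          rw [mul_comm U.card, pow_mul]
      _ ≤ _ := by
          refine pow_le_pow_left₀ (by positivity) ?_ _
          rw [← Real.exp_nat_mul, Real.exp_le_exp]
          have := mul_le_mul_of_nonneg_left hgood.2 (mul_nonneg (sq_nonneg p) hx0)
          linarith
  · -- few edges meet `U`, so the bounds on the whole graph imply those on the graph outside `U`
    have hfalse : ∀ T ⊆ vertexPairs V \ pairsIn Uᶜ, ((a ≤ (H ∪ T).card ∧
          ∀ x, ((H ∪ T) ∩ pairsAt x).card ≤ D) ∧ IsIsolated U (H ∪ T)) → False := by
      rintro T hT ⟨⟨hcard, hdeg⟩, -⟩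
      refine hgood ⟨fun x => (Finset.card_le_card (Finset.inter_subset_inter_right
        Finset.subset_union_left)).trans (hdeg x), ?_⟩
      have hsub : H ∪ T ⊆ H ∪ U.biUnion fun u => (H ∪ T) ∩ pairsAt u := by
        intro e he
        rcases Finset.mem_union.1 he with heH | heT
        · exact Finset.mem_union_left _ heH
        · obtain ⟨hev, hein⟩ := Finset.mem_sdiff.1 (hT heT)
          have : ∃ x ∈ e, x ∈ U := by
            by_contra hcon
            push Not at hcon
            exact hein (Finset.mem_filter.2 ⟨hev, fun x hx => Finset.mem_compl.2 (hcon x hx)⟩)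
          obtain ⟨x, hxe, hxU⟩ := this
          exact Finset.mem_union_right _ (Finset.mem_biUnion.2
            ⟨x, hxU, Finset.mem_inter.2 ⟨he, Finset.mem_filter.2 ⟨hev, hxe⟩⟩⟩)
      have h2 := (Finset.card_le_card hsub).trans ((Finset.card_union_le _ _).trans
        (Nat.add_le_add_left (Finset.card_biUnion_le_card_mul U _ D fun u _ => hdeg u) _))
      have h3 : ((H ∪ T).card : ℝ) ≤ H.card + U.card * D := by exact_mod_cast h2
      linarith
    refine (bprob_mono h0 h1 hfalse).trans ?_
    have : bprob p (vertexPairs V \ pairsIn Uᶜ) (fun _ => False) = 0 := by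
      simp [bprob]
    rw [this]
    positivity

lemma bprob_no_edge_between (A B : Finset V) (hAB : Disjoint A B) :
    bprob p (vertexPairs V) (fun S => ∀ a ∈ A, ∀ b ∈ B, s(a, b) ∉ S) =
      (1 - p) ^ (A.card * B.card) := by
  set T : Finset (Sym2 V) := (A ×ˢ B).image fun x => s(x.1, x.2) with hT
  have hinj : Set.InjOn (fun x : V × V => s(x.1, x.2)) (A ×ˢ B : Finset (V × V)) := by
    rintro ⟨a, b⟩ h ⟨a', b'⟩ h' heq
    rw [Finset.mem_coe, Finset.mem_product] at h h'
    rcases Sym2.eq_iff.1 heq with ⟨rfl, rfl⟩ | ⟨h1, -⟩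
    · rfl
    · exact absurd (h1 ▸ h'.2) (Finset.disjoint_left.1 hAB h.1)
  have hcard : T.card = A.card * B.card := by
    rw [hT, Finset.card_image_of_injOn hinj, Finset.card_product]
  have hsub : T ⊆ vertexPairs V := by
    intro e he
    obtain ⟨⟨a, b⟩, hab, rfl⟩ := Finset.mem_image.1 he
    rw [Finset.mem_product] at hab
    exact mk_mem_vertexPairs.2 fun h => Finset.disjoint_left.1 hAB hab.1 (h ▸ hab.2)
  rw [← hcard, ← bprob_disjoint hsub]
  refine bprob_congr fun S _ => ?_
  rw [disjoint_comm, Finset.disjoint_left]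
  constructor
  · intro h e heT heS
    obtain ⟨⟨a, b⟩, hab, rfl⟩ := Finset.mem_image.1 heT
    rw [Finset.mem_product] at hab
    exact h a hab.1 b hab.2 heS
  · intro h a ha b hb
    exact h (Finset.mem_image.2 ⟨(a, b), Finset.mem_product.2 ⟨ha, hb⟩, rfl⟩)

/-- Union bound for the failure of mixing. The error terms account for two large sets without an
edge between them, for having at most `a` edges, for a vertex of degree at least `D`, and for a
small isolated set of vertices in the absence of these defects. -/
theorem bprob_not_isMixing_le (h0 : 0 ≤ p) (h1 : p ≤ 1) {κ : ℝ} (hκ : 0 ≤ κ) {D : ℕ} {a b s : ℝ}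
    (hDp : 2 * D * p ≤ 1) (hab : b ≤ a - 2 * κ * D) (hs : 0 ≤ s) :
    bprob p (vertexPairs V) (fun S => ¬ IsMixing κ (SimpleGraph.fromEdgeSet (S : Set (Sym2 V)))) ≤
      4 ^ Fintype.card V * Real.exp (-(p * κ ^ 2)) +
      (Real.exp (p * (Fintype.card V).choose 2 * (Real.exp (-s) - 1) + s * a) +
        Fintype.card V * Real.exp (p * Fintype.card V * (Real.exp 1 - 1) - D)) +
      (Real.exp (Fintype.card V * Real.exp (-(p ^ 2 * (1 - 2 * D * p) * b))) - 1) := by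
  set E := vertexPairs V with hE
  set x := Real.exp (-(p ^ 2 * (1 - 2 * D * p) * b)) with hx
  set I₁ : Finset (Finset V × Finset V) := Finset.univ.filter fun X =>
    Disjoint X.1 X.2 ∧ κ ≤ X.1.card ∧ κ ≤ X.2.card with hI₁
  set I₂ : Finset (Finset V) := Finset.univ.filter fun U =>
    U.Nonempty ∧ (U.card : ℝ) ≤ 2 * κ with hI₂
  have hcover : ∀ S ⊆ E, ¬ IsMixing κ (SimpleGraph.fromEdgeSet (S : Set (Sym2 V))) →
      ((∃ X ∈ I₁, ∀ a ∈ X.1, ∀ b ∈ X.2, s(a, b) ∉ S) ∨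
        ((S ∩ E).card ≤ a ∨ ∃ x ∈ Finset.univ, (D : ℝ) ≤ (S ∩ pairsAt x).card)) ∨
      ∃ U ∈ I₂, (a ≤ S.card ∧ ∀ x, (S ∩ pairsAt x).card ≤ D) ∧ IsIsolated U S := by
    intro S hS hmix
    by_contra hcon
    push Not at hcon
    obtain ⟨⟨hno, hedges, hdeg⟩, hiso⟩ := hcon
    rw [Finset.inter_eq_left.2 hS] at hedges
    refine hmix ⟨fun A B hAB hA hB => ?_, fun U hU hUκ => ?_⟩
    · obtain ⟨x, hx, y, hy, hxy⟩ := hno (A, B) (Finset.mem_filter.2 ⟨Finset.mem_univ _, hAB, hA, hB⟩)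
      exact ⟨x, hx, y, hy, (SimpleGraph.fromEdgeSet_adj _).2
        ⟨hxy, mk_mem_vertexPairs.1 (hS hxy)⟩⟩
    · have := hiso U (Finset.mem_filter.2 ⟨Finset.mem_univ _, hU, hUκ⟩) ⟨hedges.le, fun x => by
        have := hdeg x (Finset.mem_univ x)
        exact_mod_cast this.le⟩
      unfold IsIsolated at this
      push Not at this
      obtain ⟨u, hu, y, hy, z, hz, huy, huz, hyz⟩ := this
      have hadj {a b : V} (h : s(a, b) ∈ S) :
          (SimpleGraph.fromEdgeSet (S : Set (Sym2 V))).Adj a b :=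
        (SimpleGraph.fromEdgeSet_adj _).2 ⟨h, mk_mem_vertexPairs.1 (hS h)⟩
      exact ⟨u, hu, y, hy, z, hz, hadj huy, hadj huz, hadj hyz⟩
  refine (bprob_mono h0 h1 hcover).trans ((bprob_or_le h0 h1).trans (add_le_add
    ((bprob_or_le h0 h1).trans (add_le_add ?_ ((bprob_or_le h0 h1).trans (add_le_add ?_ ?_)))) ?_))
  · refine (bprob_exists_le h0 h1 _ _).trans ?_
    have hterm : ∀ X ∈ I₁, bprob p E (fun S => ∀ a ∈ X.1, ∀ b ∈ X.2, s(a, b) ∉ S) ≤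
        Real.exp (-(p * κ ^ 2)) := by
      intro X hX
      obtain ⟨-, hdis, hA, hB⟩ := Finset.mem_filter.1 hX
      rw [bprob_no_edge_between _ _ hdis]
      calc (1 - p) ^ (X.1.card * X.2.card) ≤ Real.exp (-p) ^ (X.1.card * X.2.card) :=
            pow_le_pow_left₀ (by linarith) (by linarith [Real.add_one_le_exp (-p)]) _
        _ ≤ _ := by
            rw [← Real.exp_nat_mul, Real.exp_le_exp]
            push_cast
            have : κ ^ 2 ≤ (X.1.card : ℝ) * X.2.card := by
              rw [sq]; exact mul_le_mul hA hB hκ (hκ.trans hA)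
            nlinarith
    refine (Finset.sum_le_sum hterm).trans ?_
    rw [Finset.sum_const, nsmul_eq_mul]
    refine mul_le_mul_of_nonneg_right ?_ (Real.exp_pos _).le
    have : I₁.card ≤ 4 ^ Fintype.card V := by
      refine (Finset.card_le_univ _).trans ?_
      rw [Fintype.card_prod, Fintype.card_finset, ← mul_pow]
      norm_num
    exact_mod_cast this
  · refine (bprob_card_inter_le h0 h1 subset_rfl hs).trans_eq ?_
    rw [card_vertexPairs]
  · refine (bprob_exists_le h0 h1 _ _).trans ?_
    have hterm : ∀ x ∈ (Finset.univ : Finset V),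
        bprob p E (fun S => (D : ℝ) ≤ (S ∩ pairsAt x).card) ≤
          Real.exp (p * Fintype.card V * (Real.exp 1 - 1) - D) := by
      intro x _
      refine (bprob_le_card_inter h0 h1 (pairsAt_subset x) zero_le_one).trans ?_
      rw [Real.exp_le_exp, one_mul]
      have h2 : ((pairsAt x).card : ℝ) ≤ Fintype.card V := by exact_mod_cast card_pairsAt_le x
      have h3 : 0 ≤ Real.exp 1 - 1 := by linarith [Real.one_le_exp zero_le_one]
      gcongr
    refine (Finset.sum_le_sum hterm).trans ?_
    rw [Finset.sum_const, nsmul_eq_mul, Finset.card_univ]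
  · refine (bprob_exists_le h0 h1 _ _).trans ?_
    have hterm : ∀ U ∈ I₂, bprob p E (fun S => (a ≤ S.card ∧ ∀ x, (S ∩ pairsAt x).card ≤ D) ∧
        IsIsolated U S) ≤ x ^ U.card := by
      intro U hU
      obtain ⟨-, -, hUκ⟩ := Finset.mem_filter.1 hU
      refine bprob_isIsolated_and_le h0 h1 U hDp (hab.trans ?_)
      have : (U.card : ℝ) * D ≤ 2 * κ * D := by gcongr
      linarith
    refine (Finset.sum_le_sum hterm).trans ?_
    have hsub : I₂ ⊆ Finset.univ.erase ∅ := by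
      intro U hU
      obtain ⟨-, hne, -⟩ := Finset.mem_filter.1 hU
      exact Finset.mem_erase.2 ⟨hne.ne_empty, Finset.mem_univ U⟩
    refine (Finset.sum_le_sum_of_subset_of_nonneg hsub fun _ _ _ =>
      pow_nonneg (Real.exp_pos _).le _).trans ?_
    have htotal : ∑ U : Finset V, x ^ U.card = (x + 1) ^ Fintype.card V := by
      rw [← Fintype.sum_pow_mul_eq_add_pow]
      simp
    have := Finset.add_sum_erase Finset.univ (fun U : Finset V => x ^ U.card) (Finset.mem_univ ∅)
    rw [htotal, Finset.card_empty, pow_zero] at this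
    have h4 : (x + 1) ^ Fintype.card V ≤ Real.exp (Fintype.card V * x) := by
      rw [Real.exp_nat_mul]
      exact pow_le_pow_left₀ (by positivity) (Real.add_one_le_exp x) _
    linarith

end Upper

/-! ### Below the threshold, some vertex is in no triangle -/

section SecondMoment

variable {α : Type*} [DecidableEq α] {p : ℝ} {B : Finset α}

/-- Second moment method: if the events `P i` are pairwise independent and `Q i` has conditional
probability at most `η` given `P i`, then it is likely that some `P i` occurs without `Q i`. -/
lemma bprob_not_exists_le (h0 : 0 ≤ p) (h1 : p ≤ 1) {ι : Type*} (J : Finset ι)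
    {P Q : ι → Finset α → Prop} {η q : ℝ} (hq : 0 < q) (hJ : J.Nonempty)
    (hP : ∀ i ∈ J, q ≤ bprob p B (P i))
    (hind : ∀ i ∈ J, ∀ j ∈ J, i ≠ j →
      bprob p B (fun S => P i S ∧ P j S) = bprob p B (P i) * bprob p B (P j))
    (hQ : ∀ i ∈ J, bprob p B (fun S => P i S ∧ Q i S) ≤ η * bprob p B (P i)) :
    bprob p B (fun S => ¬ ∃ i ∈ J, P i S ∧ ¬ Q i S) ≤ 2 * η + 1 / (J.card * q) := by
  classical
  set μ : ℝ := ∑ i ∈ J, bprob p B (P i) with hμ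
  have hJpos : (0 : ℝ) < J.card := by exact_mod_cast hJ.card_pos
  have hμq : J.card * q ≤ μ := by
    rw [← nsmul_eq_mul]
    exact Finset.card_nsmul_le_sum _ _ _ hP
  have hμpos : 0 < μ := lt_of_lt_of_le (by positivity) hμq
  set X : Finset α → ℝ := fun S => ∑ i ∈ J, if P i S then 1 else 0 with hX
  set Y : Finset α → ℝ := fun S => ∑ i ∈ J, if P i S ∧ Q i S then 1 else 0 with hY
  have hEX : bexp p B X = μ := by
    rw [hX, bexp_sum]
    rfl
  have hEY : bexp p B Y ≤ η * μ := by
    rw [hY, bexp_sum, hμ, Finset.mul_sum]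
    exact Finset.sum_le_sum fun i hi => by
      refine le_trans (le_of_eq ?_) (hQ i hi)
      rw [bprob]
      congr!
  have hEX2 : bexp p B (fun S => X S * X S) ≤ μ + μ * μ := by
    have h2 : (fun S => X S * X S) = fun S => ∑ i ∈ J, ∑ j ∈ J, if P i S ∧ P j S then 1 else 0 := by
      ext S
      simp only [hX, Finset.sum_mul_sum, ite_and]
      refine Finset.sum_congr rfl fun i _ => Finset.sum_congr rfl fun j _ => ?_
      split_ifs <;> simp
    rw [h2, bexp_sum]
    have h3 : μ + μ * μ = ∑ i ∈ J, (bprob p B (P i) + ∑ j ∈ J, bprob p B (P i) * bprob p B (P j)) := by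
      rw [Finset.sum_add_distrib, ← Finset.sum_mul_sum]
    rw [h3]
    refine Finset.sum_le_sum fun i hi => ?_
    rw [bexp_sum, ← Finset.add_sum_erase _ _ hi, ← Finset.add_sum_erase J (fun j => _ * _) hi]
    have h4 : bexp p B (fun S => if P i S ∧ P i S then 1 else 0) = bprob p B (P i) :=
      bexp_congr fun S _ => by simp only [and_self]
    have h5 : 0 ≤ bprob p B (P i) * bprob p B (P i) := mul_self_nonneg _
    have h6 : ∑ j ∈ J.erase i, bexp p B (fun S => if P i S ∧ P j S then 1 else 0) =
        ∑ j ∈ J.erase i, bprob p B (P i) * bprob p B (P j) := by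
      refine Finset.sum_congr rfl fun j hj => ?_
      rw [← hind i hi j (Finset.mem_of_mem_erase hj) (Finset.ne_of_mem_erase hj).symm, bprob]
      congr!
    rw [h4, h6]
    linarith
  -- on the event, `X = Y`, and therefore `1 ≤ (1 - X / μ) ^ 2 + 2 * Y / μ`
  have hmarkov : bprob p B (fun S => ¬ ∃ i ∈ J, P i S ∧ ¬ Q i S) ≤
      bexp p B (fun S => 1 - 2 / μ * X S + (1 / μ ^ 2 * (X S * X S) + 2 / μ * Y S)) := by
    have hrw (S : Finset α) : 1 - 2 / μ * X S + (1 / μ ^ 2 * (X S * X S) + 2 / μ * Y S) =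
        (1 - X S / μ) ^ 2 + 2 / μ * Y S := by field_simp; ring
    have hY0 (S : Finset α) : 0 ≤ Y S := Finset.sum_nonneg fun i _ => by split_ifs <;> norm_num
    refine bprob_le_bexp h0 h1 (fun S _ => ?_) fun S _ hS => ?_
    · rw [hrw]
      have := hY0 S
      positivity
    · have hXY : X S = Y S := by
        refine Finset.sum_congr rfl fun i hi => ?_
        push Not at hS
        have := hS i hi
        split_ifs <;> tauto
      rw [hXY]
      have : 0 ≤ 1 / μ ^ 2 * (Y S * Y S) := mul_nonneg (by positivity) (mul_self_nonneg _)
      linarith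
  rw [bexp_add, bexp_add, bexp_sub, bexp_const, bexp_const_mul, bexp_const_mul, bexp_const_mul,
    hEX] at hmarkov
  have h7 : 1 / μ ^ 2 * bexp p B (fun S => X S * X S) ≤ 1 / μ ^ 2 * (μ + μ * μ) :=
    mul_le_mul_of_nonneg_left hEX2 (by positivity)
  have h8 : 2 / μ * bexp p B Y ≤ 2 / μ * (η * μ) := mul_le_mul_of_nonneg_left hEY (by positivity)
  have h9 : 1 / μ ^ 2 * (μ + μ * μ) = 1 / μ + 1 := by field_simp
  have h10 : 2 / μ * (η * μ) = 2 * η := by field_simp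
  have h11 : 2 / μ * μ = 2 := by field_simp
  have h12 : 1 / μ ≤ 1 / (J.card * q) := one_div_le_one_div_of_le (by positivity) hμq
  linarith

end SecondMoment

section Lower

variable {V : Type*} [Fintype V] [DecidableEq V] {p : ℝ}

/-- The random set `T` of pairs contains no two pairs that join `v` to the two ends of an edge
of `H`. -/
def AvoidsSpokes (H : Finset (Sym2 V)) (v : V) (T : Finset (Sym2 V)) : Prop :=
  ∀ e ∈ H, ¬ spokes v e ⊆ T

/-- The vertex `v` is in a triangle with edges in `T` and a second vertex in `S`. -/
def HasTriangleThrough (S : Finset V) (v : V) (T : Finset (Sym2 V)) : Prop :=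
  ∃ x ∈ S ×ˢ (Finset.univ : Finset V), (v ≠ x.1 ∧ v ≠ x.2 ∧ x.1 ≠ x.2) ∧
    ({s(v, x.1), s(v, x.2), s(x.1, x.2)} : Finset (Sym2 V)) ⊆ T

/-- Given the graph `H` outside `S`, it is likely that a vertex of `S` is in no triangle. -/
lemma bprob_forall_triangle_le (h0 : 0 ≤ p) (h1 : p < 1) {S : Finset V} (hS : S.Nonempty)
    {H : Finset (Sym2 V)} (hH : H ⊆ pairsIn Sᶜ) :
    bprob p (vertexPairs V \ pairsIn Sᶜ) (fun T => ¬ ∃ v ∈ S, AvoidsSpokes H v T ∧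
      ¬ HasTriangleThrough S v T) ≤
      2 * (S.card * Fintype.card V * p ^ 3) + 1 / (S.card * (1 - p ^ 2) ^ H.card) := by
  set B := vertexPairs V \ pairsIn Sᶜ with hB
  have hspokes {v : V} (hv : v ∈ S) : ∀ e ∈ H, spokes v e ⊆ B := fun e he =>
    spokes_subset (by simpa using hv) (hH he)
  have hp2 : 0 < 1 - p ^ 2 := by nlinarith
  refine bprob_not_exists_le h0 h1.le S (by positivity) hS ?_ ?_ ?_
  · intro v hv
    exact le_bprob_avoid h0 h1.le H (hspokes hv)
      fun e he => card_spokes v (not_isDiag_of_mem_pairsIn (hH he))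
  · intro u hu v hv huv
    classical
    have hdep (v : V) (T : Finset (Sym2 V)) : (if AvoidsSpokes H v T then (1 : ℝ) else 0) =
        if AvoidsSpokes H v (T ∩ H.biUnion (spokes v)) then 1 else 0 := by
      have : AvoidsSpokes H v T ↔ AvoidsSpokes H v (T ∩ H.biUnion (spokes v)) := by
        refine forall₂_congr fun e he => not_congr ?_
        rw [Finset.subset_inter_iff, and_iff_left (Finset.subset_biUnion_of_mem _ he)]
      simp only [this]
    have hdis : Disjoint (H.biUnion (spokes u)) (H.biUnion (spokes v)) := by
      rw [Finset.disjoint_left]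
      intro f hf hf'
      obtain ⟨e, he, hfe⟩ := Finset.mem_biUnion.1 hf
      obtain ⟨e', he', hfe'⟩ := Finset.mem_biUnion.1 hf'
      obtain ⟨x, hx, rfl⟩ := mem_spokes.1 hfe
      obtain ⟨y, hy, hxy⟩ := mem_spokes.1 hfe'
      have hyS := (Finset.mem_filter.1 (hH he')).2 y hy
      rcases Sym2.eq_iff.1 hxy with ⟨h, -⟩ | ⟨-, h⟩
      · exact huv h.symm
      · rw [h, Finset.mem_compl] at hyS
        exact hyS hu
    have := bexp_mul_of_disjoint (p := p) (A := B) hdis (hdep u) (hdep v)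
    rw [bprob, bprob, bprob]
    convert this using 2
    · ext T
      by_cases h1 : AvoidsSpokes H u T <;> by_cases h2 : AvoidsSpokes H v T <;> simp [h1, h2]
  · intro v hv
    have hmono : bprob p B (fun T => AvoidsSpokes H v T ∧ HasTriangleThrough S v T) ≤
        bprob p B (fun T => ∃ x ∈ (S ×ˢ (Finset.univ : Finset V)).filter (fun x =>
          v ≠ x.1 ∧ v ≠ x.2 ∧ x.1 ≠ x.2),
          ({s(v, x.1), s(v, x.2), s(x.1, x.2)} : Finset (Sym2 V)) ⊆ T ∧ AvoidsSpokes H v T) := by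
      refine bprob_mono h0 h1.le ?_
      rintro T - ⟨hA, x, hx, hne, hT⟩
      exact ⟨x, Finset.mem_filter.2 ⟨hx, hne⟩, hT, hA⟩
    refine hmono.trans ((bprob_exists_le h0 h1.le _ _).trans ?_)
    have hterm : ∀ x ∈ (S ×ˢ (Finset.univ : Finset V)).filter (fun x =>
          v ≠ x.1 ∧ v ≠ x.2 ∧ x.1 ≠ x.2),
        bprob p B (fun T => ({s(v, x.1), s(v, x.2), s(x.1, x.2)} : Finset (Sym2 V)) ⊆ T ∧
          AvoidsSpokes H v T) ≤ p ^ 3 * bprob p B (AvoidsSpokes H v) := by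
      rintro ⟨s, w⟩ hx
      obtain ⟨hx, hvs, hvw, hsw⟩ := Finset.mem_filter.1 hx
      have hs : s ∈ S := (Finset.mem_product.1 hx).1
      dsimp only at hvs hvw hsw ⊢
      have hcard : ({s(v, s), s(v, w), s(s, w)} : Finset (Sym2 V)).card = 3 := by
        rw [Finset.card_eq_three]
        refine ⟨_, _, _, ?_, ?_, ?_, rfl⟩
        · rw [Ne, Sym2.congr_right]; exact hsw
        · rw [Sym2.eq_swap, Ne, Sym2.congr_right]; exact hvw
        · rw [Sym2.eq_swap, Sym2.eq_swap (a := s), Ne, Sym2.congr_right]; exact hvs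
      have := bprob_superset_and_le (A := B) (T := {s(v, s), s(v, w), s(s, w)})
        (P := AvoidsSpokes H v) h0 h1.le ?_ fun T T' hTT' hT' e he hsub =>
          hT' e he (hsub.trans hTT')
      · rwa [hcard] at this
      · simp only [Finset.insert_subset_iff, Finset.singleton_subset_iff, hB, Finset.mem_sdiff,
          mk_mem_vertexPairs, mk_mem_pairsIn, Finset.mem_compl]
        tauto
    refine (Finset.sum_le_sum hterm).trans ?_
    rw [Finset.sum_const, nsmul_eq_mul, ← mul_assoc]
    refine mul_le_mul_of_nonneg_right ?_ (bprob_nonneg h0 h1.le)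
    refine mul_le_mul_of_nonneg_right ?_ (by positivity)
    have := Finset.card_filter_le (S ×ˢ (Finset.univ : Finset V)) (fun x =>
          v ≠ x.1 ∧ v ≠ x.2 ∧ x.1 ≠ x.2)
    rw [Finset.card_product, Finset.card_univ] at this
    exact_mod_cast this

/-- A connected graph without NAC-colourings has more than `a` edges, or at most `a` edges while
every vertex of `S` is in a triangle; both are unlikely. -/
theorem bprob_connectedNoNAC_le (h0 : 0 ≤ p) (h1 : p < 1) (hn : 3 ≤ Fintype.card V) {S : Finset V}
    (hS : S.Nonempty) {a s : ℝ} (hs : 0 ≤ s) :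
    bprob p (vertexPairs V) (fun E => ConnectedNoNAC (SimpleGraph.fromEdgeSet (E : Set (Sym2 V)))) ≤
      Real.exp (p * (Fintype.card V).choose 2 * (Real.exp s - 1) - s * a) +
      (2 * (S.card * Fintype.card V * p ^ 3) +
        Real.exp (p ^ 2 / (1 - p ^ 2) * a) / S.card) := by
  have hp2 : 0 < 1 - p ^ 2 := by nlinarith
  have hSpos : (0 : ℝ) < S.card := by exact_mod_cast hS.card_pos
  set C : Finset (Sym2 V) → Prop := fun E =>
    ConnectedNoNAC (SimpleGraph.fromEdgeSet (E : Set (Sym2 V))) with hC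
  have hsplit : bprob p (vertexPairs V) C ≤
      bprob p (vertexPairs V) (fun E => a ≤ (E ∩ vertexPairs V).card) +
        bprob p (vertexPairs V) (fun E => E.card ≤ a ∧ C E) := by
    refine (bprob_mono h0 h1.le fun E hE hCE => ?_).trans (bprob_or_le h0 h1.le)
    rw [Finset.inter_eq_left.2 hE]
    exact (le_total a E.card).imp_right fun h => ⟨h, hCE⟩
  refine hsplit.trans (add_le_add ?_ ?_)
  · refine (bprob_le_card_inter h0 h1.le subset_rfl hs).trans_eq ?_
    rw [card_vertexPairs]
  have hunion : vertexPairs V = pairsIn Sᶜ ∪ (vertexPairs V \ pairsIn Sᶜ) :=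
    (Finset.union_sdiff_of_subset (pairsIn_subset _)).symm
  rw [hunion]
  refine bprob_union_le h0 h1.le Finset.disjoint_sdiff fun H hH => ?_
  by_cases hHa : (H.card : ℝ) ≤ a
  · refine (bprob_mono h0 h1.le (Q := fun T => ¬ ∃ v ∈ S, AvoidsSpokes H v T ∧
      ¬ HasTriangleThrough S v T) ?_).trans ((bprob_forall_triangle_le h0 h1 hS hH).trans ?_)
    · rintro T hT ⟨-, hconn, hno⟩ ⟨v, hv, hA, hB⟩
      -- an edge with an end in `S` belongs to `T`, any other edge to `H`
      have hTmem {x y : V} (hx : x ∈ S) (hxy : s(x, y) ∈ H ∪ T) : s(x, y) ∈ T :=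
        (Finset.mem_union.1 hxy).resolve_left fun h =>
          Finset.mem_compl.1 (mk_mem_pairsIn.1 (hH h)).2.1 hx
      have hHmem {x y : V} (hx : x ∉ S) (hy : y ∉ S) (hxy : s(x, y) ∈ H ∪ T) : s(x, y) ∈ H :=
        (Finset.mem_union.1 hxy).resolve_right fun h =>
          (Finset.mem_sdiff.1 (hT h)).2 (mk_mem_pairsIn.2 ⟨mk_mem_vertexPairs.1
            (Finset.mem_sdiff.1 (hT h)).1, Finset.mem_compl.2 hx, Finset.mem_compl.2 hy⟩)
      refine hno (exists_isNACColouring_of_no_triangle hconn hn (v := v) fun x y hvx hvy hxy => ?_)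
      simp only [SimpleGraph.fromEdgeSet_adj, Finset.mem_coe] at hvx hvy hxy
      have hvxT := hTmem hv hvx.1
      have hvyT := hTmem hv hvy.1
      by_cases hx : x ∈ S
      · refine hB ⟨(x, y), by simp [hx], ⟨hvx.2, hvy.2, hxy.2⟩, ?_⟩
        simp only [Finset.insert_subset_iff, Finset.singleton_subset_iff]
        exact ⟨hvxT, hvyT, hTmem hx hxy.1⟩
      by_cases hy : y ∈ S
      · refine hB ⟨(y, x), by simp [hy], ⟨hvy.2, hvx.2, hxy.2.symm⟩, ?_⟩
        simp only [Finset.insert_subset_iff, Finset.singleton_subset_iff]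
        exact ⟨hvyT, hvxT, hTmem hy (Sym2.eq_swap ▸ hxy.1)⟩
      · refine hA _ (hHmem hx hy hxy.1) ?_
        simp only [spokes_mk, Finset.insert_subset_iff, Finset.singleton_subset_iff]
        exact ⟨hvxT, hvyT⟩
    · have hbase : Real.exp (-(p ^ 2 / (1 - p ^ 2))) ≤ 1 - p ^ 2 := by
        rw [Real.exp_neg, inv_le_comm₀ (Real.exp_pos _) hp2]
        refine le_trans (le_of_eq ?_) (Real.add_one_le_exp _)
        field_simp
        ring
      have hpow : Real.exp (-(p ^ 2 / (1 - p ^ 2) * a)) ≤ (1 - p ^ 2) ^ H.card := by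
        refine le_trans ?_ (pow_le_pow_left₀ (Real.exp_pos _).le hbase _)
        rw [← Real.exp_nat_mul, Real.exp_le_exp]
        have := mul_le_mul_of_nonneg_left hHa (by positivity : 0 ≤ p ^ 2 / (1 - p ^ 2))
        linarith
      have : 1 / (S.card * (1 - p ^ 2) ^ H.card) ≤ Real.exp (p ^ 2 / (1 - p ^ 2) * a) / S.card := by
        rw [div_le_div_iff₀ (mul_pos hSpos (pow_pos hp2 _)) hSpos, one_mul]
        calc (S.card : ℝ) = Real.exp (p ^ 2 / (1 - p ^ 2) * a) *
              (S.card * Real.exp (-(p ^ 2 / (1 - p ^ 2) * a))) := by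
              rw [mul_left_comm, ← Real.exp_add, add_neg_cancel, Real.exp_zero, mul_one]
          _ ≤ _ := mul_le_mul_of_nonneg_left (mul_le_mul_of_nonneg_left hpow hSpos.le)
              (Real.exp_pos _).le
      linarith
  · have hfalse : ∀ T ⊆ vertexPairs V \ pairsIn Sᶜ, (((H ∪ T).card : ℝ) ≤ a ∧ C (H ∪ T)) →
        False := by
      rintro T - ⟨hcard, -⟩
      refine hHa (le_trans ?_ hcard)
      exact_mod_cast Finset.card_le_card Finset.subset_union_left
    refine (bprob_mono h0 h1.le hfalse).trans ?_
    have : bprob p (vertexPairs V \ pairsIn Sᶜ) (fun _ => False) = 0 := by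
      simp [bprob]
    rw [this]
    have h2 : 0 ≤ 2 * (S.card * Fintype.card V * p ^ 3) := mul_nonneg two_pos.le
      (mul_nonneg (mul_nonneg (Nat.cast_nonneg _) (Nat.cast_nonneg _)) (pow_nonneg h0 3))
    exact add_nonneg h2 (div_nonneg (Real.exp_pos _).le hSpos.le)

end Lower

/-! ### Asymptotics of the threshold -/

/-- The edge probability at which a given vertex lies in `log n` triangles on average. -/
noncomputable def nacThreshold (n : ℕ) : ℝ :=
  (2 * Real.log (n : ℝ) / (n : ℝ) ^ 2) ^ ((1 : ℝ) / 3)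

lemma nacThreshold_nonneg (n : ℕ) : 0 ≤ nacThreshold n := by
  unfold nacThreshold
  have := Real.log_natCast_nonneg n
  positivity

lemma sq_mul_nacThreshold_pow_three {n : ℕ} (hn : n ≠ 0) :
    (n : ℝ) ^ 2 * nacThreshold n ^ 3 = 2 * Real.log n := by
  have h0 := Real.log_natCast_nonneg n
  have hn' : (n : ℝ) ≠ 0 := by exact_mod_cast hn
  rw [nacThreshold, ← Real.rpow_natCast (_ ^ _) 3, ← Real.rpow_mul (by positivity)]
  norm_num
  field_simp

lemma tendsto_log_natCast : Tendsto (fun n : ℕ => Real.log n) atTop atTop :=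
  Real.tendsto_log_atTop.comp tendsto_natCast_atTop_atTop

lemma tendsto_log_sq_div : Tendsto (fun n : ℕ => Real.log n ^ 2 / (n : ℝ)) atTop (𝓝 0) :=
  (Real.isLittleO_pow_log_id_atTop (n := 2)).tendsto_div_nhds_zero.comp
    tendsto_natCast_atTop_atTop

/-- The square of the average degree at the threshold is of smaller order than the number of
vertices. -/
lemma tendsto_mul_nacThreshold_sq :
    Tendsto (fun n : ℕ => (n : ℝ) * nacThreshold n ^ 2) atTop (𝓝 0) := by
  have h : Tendsto (fun n : ℕ => (4 * (Real.log n ^ 2 / (n : ℝ))) ^ ((1 : ℝ) / 3)) atTop (𝓝 0) := by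
    have := (tendsto_log_sq_div.const_mul 4).rpow_const (p := (1 : ℝ) / 3) (Or.inr (by norm_num))
    simpa using this
  refine h.congr' ?_
  filter_upwards [eventually_ge_atTop 1] with n hn
  have hn' : (n : ℝ) ≠ 0 := by exact_mod_cast (by omega : n ≠ 0)
  have h3 := sq_mul_nacThreshold_pow_three (n := n) (by omega)
  have h0 := nacThreshold_nonneg n
  have : 4 * (Real.log n ^ 2 / (n : ℝ)) = ((n : ℝ) * nacThreshold n ^ 2) ^ (3 : ℕ) := by
    have : Real.log n = (n : ℝ) ^ 2 * nacThreshold n ^ 3 / 2 := by linarith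
    rw [this]
    field_simp
    ring
  rw [this, ← Real.rpow_natCast, ← Real.rpow_mul (by positivity)]
  norm_num

lemma tendsto_nacThreshold : Tendsto nacThreshold atTop (𝓝 0) := by
  have h : Tendsto (fun n => nacThreshold n ^ 2) atTop (𝓝 0) := by
    refine squeeze_zero' (.of_forall fun n => by positivity) ?_ tendsto_mul_nacThreshold_sq
    filter_upwards [eventually_ge_atTop 1] with n hn
    have : (1 : ℝ) ≤ n := by exact_mod_cast hn
    nlinarith [sq_nonneg (nacThreshold n)]
  have h2 := h.sqrt
  simp only [Real.sqrt_sq (nacThreshold_nonneg _), Real.sqrt_zero] at h2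
  exact h2

/-- The average degree at the threshold grows faster than `log n`. -/
lemma tendsto_mul_nacThreshold_div_log :
    Tendsto (fun n : ℕ => (n : ℝ) * nacThreshold n / Real.log n) atTop atTop := by
  have h : Tendsto (fun n : ℕ => (n : ℝ) / Real.log n ^ 2) atTop atTop := by
    have h2 : Tendsto (fun n : ℕ => Real.log n ^ 2 / (n : ℝ)) atTop (𝓝[>] 0) := by
      refine tendsto_nhdsWithin_iff.2 ⟨tendsto_log_sq_div, ?_⟩
      filter_upwards [tendsto_log_natCast.eventually_gt_atTop 0, eventually_gt_atTop 0] with n h1 h2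
      have : (0 : ℝ) < n := by exact_mod_cast h2
      exact div_pos (pow_pos h1 2) this
    refine h2.inv_tendsto_nhdsGT_zero.congr fun n => ?_
    simp
  have h3 := (tendsto_rpow_atTop (by norm_num : (0 : ℝ) < 1 / 3)).comp
    (h.const_mul_atTop (by norm_num : (0 : ℝ) < 2))
  refine h3.congr' ?_
  filter_upwards [tendsto_log_natCast.eventually_gt_atTop 0, eventually_gt_atTop 0] with n h1 h2
  have hn' : (n : ℝ) ≠ 0 := by exact_mod_cast (by omega : n ≠ 0)
  have h4 := sq_mul_nacThreshold_pow_three (n := n) (by omega)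
  have h0 := nacThreshold_nonneg n
  have : 2 * ((n : ℝ) / Real.log n ^ 2) = ((n : ℝ) * nacThreshold n / Real.log n) ^ (3 : ℕ) := by
    rw [div_pow, mul_pow, show (n : ℝ) ^ 3 * nacThreshold n ^ 3 = n * (n ^ 2 * nacThreshold n ^ 3) by
      ring, h4]
    field_simp
  rw [Function.comp_apply, this, ← Real.rpow_natCast, ← Real.rpow_mul (by positivity)]
  norm_num

lemma tendsto_mul_nacThreshold :
    Tendsto (fun n : ℕ => (n : ℝ) * nacThreshold n) atTop atTop := by
  refine (tendsto_mul_nacThreshold_div_log.atTop_mul_atTop₀ tendsto_log_natCast).congr' ?_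
  filter_upwards [tendsto_log_natCast.eventually_gt_atTop 0] with n h1
  field_simp

/-- Above the threshold, the random graph is mixing with high probability. -/
theorem tendsto_bprob_not_isMixing {l : ℝ} (hl : 1 < l) :
    ∃ δ : ℝ, 0 < δ ∧ 6 * δ < 1 ∧ Tendsto (fun n : ℕ => bprob (l * nacThreshold n)
      (vertexPairs (Fin n)) fun S => ¬ IsMixing (δ * n) (SimpleGraph.fromEdgeSet
        (S : Set (Sym2 (Fin n))))) atTop (𝓝 0) := by
  set c : ℝ := l ^ 3 with hc
  have hc1 : 1 < c := one_lt_pow₀ hl (by norm_num)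
  have hl0 : 0 < l := by linarith
  -- this choice gives `c * (1 - 14 * δ) = (c + 1) / 2`, which exceeds `1`
  set δ : ℝ := (1 - 1 / c) / 28 with hδ
  have hc0 : 0 < 1 / c := by positivity
  have hc2 : 1 / c < 1 := by rw [div_lt_one (by linarith)]; exact hc1
  have hδ0 : 0 < δ := by linarith
  have hcδ : c * (1 - 14 * δ) = (c + 1) / 2 := by
    rw [hδ]; field_simp; ring
  refine ⟨δ, hδ0, by linarith, ?_⟩
  set p : ℕ → ℝ := fun n => l * nacThreshold n with hp
  have hp0 (n : ℕ) : 0 ≤ p n := mul_nonneg hl0.le (nacThreshold_nonneg n)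
  have hplim : Tendsto p atTop (𝓝 0) := by simpa using tendsto_nacThreshold.const_mul l
  have hnp2 : Tendsto (fun n : ℕ => (n : ℝ) * p n ^ 2) atTop (𝓝 0) := by
    have := tendsto_mul_nacThreshold_sq.const_mul (l ^ 2)
    rw [mul_zero] at this
    exact this.congr fun n => by simp only [hp]; ring
  have hnp : Tendsto (fun n : ℕ => (n : ℝ) * p n) atTop atTop :=
    (tendsto_mul_nacThreshold.const_mul_atTop hl0).congr fun n => by simp only [hp]; ring
  have hnplog : Tendsto (fun n : ℕ => (n : ℝ) * p n / Real.log n) atTop atTop :=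
    (tendsto_mul_nacThreshold_div_log.const_mul_atTop hl0).congr fun n => by simp only [hp]; ring
  have hinv : Tendsto (fun n : ℕ => 1 / (n : ℝ)) atTop (𝓝 0) := tendsto_one_div_atTop_nhds_zero_nat
  have hnat : Tendsto (fun n : ℕ => (n : ℝ)) atTop atTop := tendsto_natCast_atTop_atTop
  set D : ℕ → ℕ := fun n => ⌈3 * (n * p n)⌉₊ with hD
  have hD1 (n : ℕ) : 3 * (n * p n) ≤ D n := Nat.le_ceil _
  have hD2 (n : ℕ) : (D n : ℝ) ≤ 3 * (n * p n) + 1 :=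
    (Nat.ceil_lt_add_one (mul_nonneg (by norm_num) (mul_nonneg (Nat.cast_nonneg n) (hp0 n)))).le
  -- the logarithmic scale of the expected number of isolated vertices
  set g : ℕ → ℝ := fun n => (1 - 6 * (n * p n ^ 2) - 2 * p n) *
    (c * ((1 - 2 * δ) * (1 - 1 / n) - 12 * δ) - 2 * δ * (n * p n ^ 2) * (1 / Real.log n)) with hg
  have hglim : Tendsto g atTop (𝓝 ((c + 1) / 2)) := by
    have hloginv : Tendsto (fun n : ℕ => 1 / Real.log n) atTop (𝓝 0) := by
      refine tendsto_log_natCast.inv_tendsto_atTop.congr fun n => ?_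
      simp
    have h1 : Tendsto g atTop (𝓝 ((1 - 6 * 0 - 2 * 0) *
        (c * ((1 - 2 * δ) * (1 - 0) - 12 * δ) - 2 * δ * 0 * 0))) :=
      ((tendsto_const_nhds.sub (hnp2.const_mul 6)).sub (hplim.const_mul 2)).mul
        ((((tendsto_const_nhds.sub hinv).const_mul _).sub_const _ |>.const_mul c).sub
          ((hnp2.const_mul _).mul hloginv))
    convert h1 using 2
    rw [← hcδ]; ring
  have e1 : Tendsto (fun n : ℕ => Real.exp (-(n * (δ ^ 2 * (n * p n) - Real.log 4)))) atTop
      (𝓝 0) :=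
    Real.tendsto_exp_neg_atTop_nhds_zero.comp (hnat.atTop_mul_atTop₀
      (tendsto_atTop_add_const_right _ _ (hnp.const_mul_atTop (by positivity))))
  have e2 : Tendsto (fun n : ℕ => Real.exp (-(δ ^ 2 * (n * p n)))) atTop (𝓝 0) :=
    Real.tendsto_exp_neg_atTop_nhds_zero.comp (hnp.const_mul_atTop (by positivity))
  have e3 : Tendsto (fun n : ℕ => Real.exp (-(Real.log n * (n * p n / Real.log n + -1)))) atTop
      (𝓝 0) :=
    Real.tendsto_exp_neg_atTop_nhds_zero.comp (tendsto_log_natCast.atTop_mul_atTop₀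
      (tendsto_atTop_add_const_right _ _ hnplog))
  have e4 : Tendsto (fun n : ℕ => Real.exp (Real.exp (-((c - 1) / 4 * Real.log n))) - 1) atTop
      (𝓝 0) := by
    have h1 := Real.tendsto_exp_neg_atTop_nhds_zero.comp
      (tendsto_log_natCast.const_mul_atTop (by linarith : 0 < (c - 1) / 4))
    have h2 := ((Real.continuous_exp.tendsto 0).comp h1).sub_const 1
    rw [Real.exp_zero, sub_self] at h2
    exact h2
  have esum := (e1.add (e2.add e3)).add e4
  simp only [add_zero] at esum
  have hple : ∀ᶠ n in atTop, p n ≤ 1 := hplim.eventually_le_const one_pos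
  refine squeeze_zero' (hple.mono fun n hn => bprob_nonneg (hp0 n) hn) ?_ esum
  have hsmall : ∀ᶠ n : ℕ in atTop, 6 * ((n : ℝ) * p n ^ 2) + 2 * p n ≤ 1 := by
    have := (hnp2.const_mul 6).add (hplim.const_mul 2)
    simp only [mul_zero, add_zero] at this
    exact this.eventually_le_const one_pos
  have hgge : ∀ᶠ n in atTop, (c + 3) / 4 ≤ g n :=
    hglim.eventually_const_le (by linarith)
  filter_upwards [hple, hsmall, hgge, eventually_ge_atTop 3,
    tendsto_log_natCast.eventually_gt_atTop 0] with n hpn hsn hgn hn3 hlog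
  have hn3' : (3 : ℝ) ≤ n := by exact_mod_cast hn3
  have hn0 : (0 : ℝ) < n := by linarith
  have hpn0 := hp0 n
  have hnpn : 0 ≤ n * p n := mul_nonneg hn0.le hpn0
  have hDp : 2 * (D n : ℝ) * p n ≤ 6 * (n * p n ^ 2) + 2 * p n := by
    have := mul_le_mul_of_nonneg_right (hD2 n) hpn0
    linarith
  have hchoose : ((n.choose 2 : ℕ) : ℝ) = n * (n - 1) / 2 := Nat.cast_choose_two ℝ n
  have hnpchoose : n * p n ≤ p n * (n * (n - 1) / 2) := by
    have := mul_le_mul_of_nonneg_left (by linarith : 1 ≤ ((n : ℝ) - 1) / 2) hnpn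
    linarith
  have hmain := bprob_not_isMixing_le (V := Fin n) (p := p n) (κ := δ * n) (D := D n)
    (a := (1 - 2 * δ) * (p n * (n * (n - 1) / 2)))
    (b := (1 - 2 * δ) * (p n * (n * (n - 1) / 2)) - 2 * (δ * n) * (3 * (n * p n) + 1)) (s := δ)
    hpn0 hpn (by positivity) (hDp.trans hsn)
    (by have := mul_le_mul_of_nonneg_left (hD2 n) (by positivity : 0 ≤ 2 * (δ * n)); linarith) hδ0.le
  rw [Fintype.card_fin, hchoose] at hmain
  refine hmain.trans (add_le_add (add_le_add ?_ (add_le_add ?_ ?_)) (sub_le_sub_right ?_ 1))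
  · have : (4 : ℝ) ^ n = Real.exp (n * Real.log 4) := by
      rw [Real.exp_nat_mul, Real.exp_log (by norm_num)]
    rw [this, ← Real.exp_add, Real.exp_le_exp]
    apply le_of_eq
    ring
  · rw [Real.exp_le_exp]
    have hexp : Real.exp (-δ) - 1 ≤ -δ + δ ^ 2 := by
      have := (abs_le.1 (Real.abs_exp_sub_one_sub_id_le (x := -δ)
        (by rw [abs_neg, abs_of_pos hδ0]; linarith))).2
      linarith
    have h1 := mul_le_mul_of_nonneg_left hexp (hnpn.trans hnpchoose)
    have h2 := mul_le_mul_of_nonneg_left hnpchoose (sq_nonneg δ)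
    linarith
  · calc (n : ℝ) * Real.exp (p n * n * (Real.exp 1 - 1) - D n)
        = Real.exp (Real.log n + (p n * n * (Real.exp 1 - 1) - D n)) := by
          rw [Real.exp_add, Real.exp_log hn0]
      _ ≤ _ := by
          rw [Real.exp_le_exp]
          have h1 : Real.log n * (n * p n / Real.log n + -1) = n * p n - Real.log n := by
            field_simp
            ring
          rw [h1]
          have h2 := hD1 n
          have h3 := Real.exp_one_lt_d9
          have h4 := mul_le_mul_of_nonneg_left (by linarith : Real.exp 1 - 1 ≤ 2) hnpn
          linarith
  · rw [Real.exp_le_exp]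
    set b := (1 - 2 * δ) * (p n * (n * (n - 1) / 2)) - 2 * (δ * n) * (3 * (n * p n) + 1) with hb
    have hcube : (n : ℝ) ^ 2 * p n ^ 3 = 2 * c * Real.log n := by
      have := sq_mul_nacThreshold_pow_three (n := n) (by omega)
      calc (n : ℝ) ^ 2 * p n ^ 3 = l ^ 3 * (n ^ 2 * nacThreshold n ^ 3) := by simp only [hp]; ring
        _ = _ := by rw [this, hc]; ring
    have hpb : (1 - 6 * (n * p n ^ 2) - 2 * p n) * (p n ^ 2 * b) = g n * Real.log n := by
      have hb2 : p n ^ 2 * b = (n ^ 2 * p n ^ 3) * ((1 - 2 * δ) * (1 - 1 / n) - 12 * δ) / 2 -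
          2 * δ * (n * p n ^ 2) := by
        rw [hb]; field_simp; ring
      rw [hb2, hcube]
      simp only [hg]
      field_simp
    have hfac : 0 ≤ 1 - 6 * (n * p n ^ 2) - 2 * p n := by linarith
    have hgpos : 0 < g n * Real.log n := mul_pos (by linarith) hlog
    have hb0 : 0 ≤ p n ^ 2 * b := by
      rw [← hpb] at hgpos
      by_contra hneg
      have := mul_nonpos_of_nonneg_of_nonpos hfac (not_le.1 hneg).le
      linarith
    have h1 : (c + 3) / 4 * Real.log n ≤ p n ^ 2 * (1 - 2 * D n * p n) * b := by
      have h2 := mul_le_mul_of_nonneg_right hgn hlog.le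
      have h3 := mul_le_mul_of_nonneg_right (by linarith :
        1 - 6 * (n * p n ^ 2) - 2 * p n ≤ 1 - 2 * D n * p n) hb0
      linarith
    calc (n : ℝ) * Real.exp (-(p n ^ 2 * (1 - 2 * D n * p n) * b))
        = Real.exp (Real.log n - p n ^ 2 * (1 - 2 * D n * p n) * b) := by
          rw [Real.exp_sub, Real.exp_log hn0, Real.exp_neg, div_eq_mul_inv]
      _ ≤ _ := by
          rw [Real.exp_le_exp]
          linarith

/-- Below the threshold, a graph with a NAC-colouring, or a disconnected one, is likely. -/
theorem tendsto_bprob_connectedNoNAC {l : ℝ} (hl0 : 0 < l) (hl1 : l < 1) {p : ℕ → ℝ}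
    (hp0 : ∀ n, 0 ≤ p n) (hpl : ∀ᶠ n in atTop, p n ≤ l * nacThreshold n) :
    Tendsto (fun n : ℕ => bprob (p n) (vertexPairs (Fin n)) fun S =>
      ConnectedNoNAC (SimpleGraph.fromEdgeSet (S : Set (Sym2 (Fin n))))) atTop (𝓝 0) := by
  set c : ℝ := l ^ 3 with hc
  have hc0 : 0 < c := by positivity
  have hc1 : c < 1 := pow_lt_one₀ hl0.le hl1 (by norm_num)
  set q : ℕ → ℝ := fun n => l * nacThreshold n with hq
  have hq0 (n : ℕ) : 0 ≤ q n := mul_nonneg hl0.le (nacThreshold_nonneg n)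
  have hqlim : Tendsto q atTop (𝓝 0) := by simpa using tendsto_nacThreshold.const_mul l
  have hnq : Tendsto (fun n : ℕ => (n : ℝ) * q n) atTop atTop :=
    (tendsto_mul_nacThreshold.const_mul_atTop hl0).congr fun n => by simp only [hq]; ring
  -- with this tilt, `(1 + 2 * s) * c` is at most `(1 + c) / 2`, hence less than `1`
  set s : ℝ := (1 - c) / 4 with hs
  have hs0 : 0 < s := by linarith
  set θ : ℝ := (1 - c) / 8 with hθ
  have hθ0 : 0 < θ := by linarith
  set m : ℕ → ℕ := fun n => ⌈(n : ℝ) ^ (1 - θ)⌉₊ with hm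
  have e1 : Tendsto (fun n : ℕ => Real.exp (-(s ^ 2 / 2 * (n * q n)))) atTop (𝓝 0) :=
    Real.tendsto_exp_neg_atTop_nhds_zero.comp (hnq.const_mul_atTop (by positivity))
  have e2 : Tendsto (fun n : ℕ => 8 * c * (Real.log n / (n : ℝ) ^ θ)) atTop (𝓝 0) := by
    have := ((isLittleO_log_rpow_atTop hθ0).tendsto_div_nhds_zero.comp
      (tendsto_natCast_atTop_atTop (R := ℝ))).const_mul (8 * c)
    rw [mul_zero] at this
    exact this
  have e3 : Tendsto (fun n : ℕ => Real.exp (-(θ * Real.log n))) atTop (𝓝 0) :=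
    Real.tendsto_exp_neg_atTop_nhds_zero.comp (tendsto_log_natCast.const_mul_atTop hθ0)
  have esum := e1.add (e2.add e3)
  simp only [add_zero] at esum
  have hqhalf : ∀ᶠ n in atTop, q n ≤ 1 / 2 := hqlim.eventually_le_const (by norm_num)
  have hqfac : ∀ᶠ n in atTop, (1 + c) / 2 ≤ (3 + c) / 4 * (1 - q n ^ 2) := by
    have h1 : Tendsto (fun n => (3 + c) / 4 * (1 - q n ^ 2)) atTop
        (𝓝 ((3 + c) / 4 * (1 - 0 ^ 2))) :=
      (tendsto_const_nhds.sub (hqlim.pow 2)).const_mul _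
    exact h1.eventually_const_le (by linarith)
  refine squeeze_zero' ?_ ?_ esum
  · filter_upwards [hpl, hqhalf] with n h1 h2
    exact bprob_nonneg (hp0 n) (h1.trans (h2.trans (by norm_num)))
  filter_upwards [hpl, hqhalf, hqfac, eventually_ge_atTop 3,
    tendsto_log_natCast.eventually_gt_atTop 0] with n hpn hqn hqf hn3 hlog
  have hn3' : (3 : ℝ) ≤ n := by exact_mod_cast hn3
  have hn0 : (0 : ℝ) < n := by linarith
  have hpn0 := hp0 n
  have hqn0 := hq0 n
  change p n ≤ q n at hpn
  have hone : (1 : ℝ) ≤ (n : ℝ) ^ (1 - θ) := Real.one_le_rpow (by linarith) (by linarith)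
  have hmle : m n ≤ n := by
    refine Nat.ceil_le.2 ?_
    calc (n : ℝ) ^ (1 - θ) ≤ (n : ℝ) ^ (1 : ℝ) :=
          Real.rpow_le_rpow_of_exponent_le (by linarith) (by linarith)
      _ = n := Real.rpow_one _
  have hm1 : (n : ℝ) ^ (1 - θ) ≤ m n := Nat.le_ceil _
  have hm2 : (m n : ℝ) ≤ 2 * (n : ℝ) ^ (1 - θ) := by
    have := (Nat.ceil_lt_add_one (by linarith : 0 ≤ (n : ℝ) ^ (1 - θ))).le
    linarith
  obtain ⟨S, -, hScard⟩ := Finset.exists_subset_card_eq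
    (s := (Finset.univ : Finset (Fin n))) (n := m n) (by simpa using hmle)
  have hmpos : (0 : ℝ) < m n := by linarith
  have hS : S.Nonempty := by
    rw [← Finset.card_pos, hScard]
    exact_mod_cast hmpos
  have hmain := bprob_connectedNoNAC_le (V := Fin n) (p := p n) (S := S)
    (a := (1 + 2 * s) * (q n * n ^ 2 / 2)) (s := s) hpn0 (by linarith) (by simpa using hn3) hS hs0.le
  rw [Fintype.card_fin, Nat.cast_choose_two, hScard] at hmain
  have hcube : (n : ℝ) ^ 2 * q n ^ 3 = 2 * c * Real.log n := by
    have := sq_mul_nacThreshold_pow_three (n := n) (by omega)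
    calc (n : ℝ) ^ 2 * q n ^ 3 = l ^ 3 * (n ^ 2 * nacThreshold n ^ 3) := by simp only [hq]; ring
      _ = _ := by rw [this, hc]; ring
  refine hmain.trans (add_le_add ?_ (add_le_add ?_ ?_))
  · rw [Real.exp_le_exp]
    have hexp : Real.exp s - 1 ≤ s + s ^ 2 := by
      have := (abs_le.1 (Real.abs_exp_sub_one_sub_id_le (x := s)
        (by rw [abs_of_pos hs0]; linarith))).2
      linarith
    have hexp0 : 0 ≤ Real.exp s - 1 := by linarith [Real.one_le_exp hs0.le]
    have h1 : p n * ((n : ℝ) * (n - 1) / 2) ≤ q n * n ^ 2 / 2 := by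
      have h2 : p n * ((n : ℝ) * (n - 1) / 2) ≤ q n * ((n : ℝ) * n / 2) := by
        gcongr
        · exact div_nonneg (mul_nonneg hn0.le (by linarith)) two_pos.le
        · linarith
      linarith
    have hqn2 : 0 ≤ q n * n ^ 2 / 2 := by positivity
    have h3 := mul_le_mul h1 hexp hexp0 hqn2
    have h4 : s ^ 2 / 2 * (n * q n) ≤ s ^ 2 / 2 * (n * q n) * n :=
      le_mul_of_one_le_right (by positivity) (by linarith)
    nlinarith
  · have h1 : 2 * (m n * n * p n ^ 3) ≤ 2 * (2 * (n : ℝ) ^ (1 - θ) * n * q n ^ 3) := by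
      gcongr
    refine h1.trans (le_of_eq ?_)
    have h2 : (n : ℝ) * q n ^ 3 = 2 * c * Real.log n / n := by
      rw [← hcube]; field_simp
    have h3 : (n : ℝ) ^ (1 - θ) = n / (n : ℝ) ^ θ := by
      rw [Real.rpow_sub hn0, Real.rpow_one]
    rw [mul_assoc (2 * (n : ℝ) ^ (1 - θ)), h2, h3]
    have : (0 : ℝ) < (n : ℝ) ^ θ := Real.rpow_pos_of_pos hn0 θ
    field_simp
    ring
  · have hq2 : 0 < 1 - q n ^ 2 := by nlinarith
    have h1 : p n ^ 2 / (1 - p n ^ 2) ≤ q n ^ 2 / (1 - q n ^ 2) := by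
      gcongr
    have h2 : p n ^ 2 / (1 - p n ^ 2) * ((1 + 2 * s) * (q n * n ^ 2 / 2)) ≤
        (3 + c) / 4 * Real.log n := by
      refine (mul_le_mul_of_nonneg_right h1 (by positivity)).trans ?_
      have h3 : q n ^ 2 / (1 - q n ^ 2) * ((1 + 2 * s) * (q n * n ^ 2 / 2)) =
          ((1 + 2 * s) * c) * Real.log n / (1 - q n ^ 2) := by
        have : Real.log n = n ^ 2 * q n ^ 3 / (2 * c) := by
          rw [hcube]; field_simp
        rw [this]
        field_simp
      rw [h3, div_le_iff₀ hq2]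
      have h4 : (1 + 2 * s) * c ≤ (1 + c) / 2 := by nlinarith
      have h5 := mul_le_mul_of_nonneg_right (h4.trans hqf) hlog.le
      linarith
    rw [div_le_iff₀ hmpos]
    calc Real.exp (p n ^ 2 / (1 - p n ^ 2) * ((1 + 2 * s) * (q n * n ^ 2 / 2)))
        ≤ Real.exp ((3 + c) / 4 * Real.log n) := Real.exp_le_exp.2 h2
      _ = Real.exp (-(θ * Real.log n)) * (n : ℝ) ^ (1 - θ) := by
          rw [Real.rpow_def_of_pos hn0, ← Real.exp_add]
          congr 1
          rw [hθ]; ring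
      _ ≤ _ := mul_le_mul_of_nonneg_left hm1 (Real.exp_pos _).le

/-! ### The sharp threshold -/

theorem theorem1 :
    IsSharpThreshold
      (fun n : ℕ => (2 * Real.log (n : ℝ) / (n : ℝ) ^ 2) ^ ((1 : ℝ) / 3))
      (fun _ G => ConnectedNoNAC G) := by
  change IsSharpThreshold nacThreshold _
  intro ε hε p
  constructor
  · intro hp
    obtain ⟨δ, hδ0, hδ1, hlim⟩ := tendsto_bprob_not_isMixing (l := 1 + ε) (by linarith)
    have hlim' : Tendsto (fun n : ℕ => 1 - bprob ((1 + ε) * nacThreshold n)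
        (vertexPairs (Fin n)) fun S => ¬ IsMixing (δ * n) (SimpleGraph.fromEdgeSet
        (S : Set (Sym2 (Fin n))))) atTop (𝓝 1) := by
      simpa using hlim.const_sub 1
    have hreal : Tendsto (fun n : ℕ => bprob (p n) (vertexPairs (Fin n)) fun S =>
        ConnectedNoNAC (SimpleGraph.fromEdgeSet (S : Set (Sym2 (Fin n))))) atTop (𝓝 1) := by
      refine tendsto_of_tendsto_of_tendsto_of_le_of_le' hlim' tendsto_const_nhds ?_
        (.of_forall fun n => bprob_le_one (p n).2.1 (p n).2.2)
      filter_upwards [hp, eventually_gt_atTop 0] with n hpn hn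
      have hn' : (0 : ℝ) < n := by exact_mod_cast hn
      rw [bprob_not, sub_sub_cancel]
      refine (bprob_mono_param (mul_nonneg (by linarith) (nacThreshold_nonneg n)) hpn.le (p n).2.2
        fun S T hST h => h.mono (SimpleGraph.fromEdgeSet_mono (by exact_mod_cast hST))).trans
          (bprob_mono (p n).2.1 (p n).2.2 fun S _ h => ?_)
      · refine h.connectedNoNAC (by positivity) ?_
        rw [Fintype.card_fin]
        nlinarith
    have := ENNReal.tendsto_ofReal hreal
    rw [ENNReal.ofReal_one] at this
    exact this.congr fun n => (binomialRandom_apply_eq_bprob (p n) _).symm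
  · intro hp
    have hε1 : ε < 1 := by
      obtain ⟨n, hn⟩ := hp.exists
      by_contra hcon
      have h1 := (p n).2.1
      have h2 := mul_nonneg (by linarith : 0 ≤ ε - 1) (nacThreshold_nonneg n)
      linarith
    have hlim := tendsto_bprob_connectedNoNAC (l := 1 - ε) (by linarith) (by linarith)
      (p := fun n => (p n : ℝ)) (fun n => (p n).2.1) (hp.mono fun n hn => hn.le)
    have hreal := hlim.const_sub 1
    rw [sub_zero] at hreal
    have := ENNReal.tendsto_ofReal hreal
    rw [ENNReal.ofReal_one] at this
    exact this.congr fun n => by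
      rw [← bprob_not]
      exact (binomialRandom_apply_eq_bprob (p n) fun G => ¬ ConnectedNoNAC G).symm
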